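/- Let $G$ be a compactly generated totally disconnected locally compact (Hausdorff) group and let $\mathcal H$ be a finite collection of non-compact, compactly generated open subgroups of $G$, no two distinct members of which are conjugate in $G$. If $G$ is hyperbolic relative to $\mathcal H$ and $G$ has exactly one rough end, then the Bowditch boundary of $G$ with respect to $\mathcal H$ is connected. Here the notions are as follows. A Cayley–Abels graph of $G$ is a locally finite connected graph on which $G$ acts by automorphisms, transitively on the vertices and with compact open vertex stabilizers; $G$ has exactly one rough end if the end space of a Cayley–Abels graph of $G$ is a single point. Choose a compact open subgroup $U$ of $G$, a compact generating set $K$ of $G$, a compact generating set $K_H$ of each $H\in\mathcal H$, and finite symmetric sets $S\subset G$ and $S_H\subset H\cap S$ containing the identity with $K\subset SU$ and $K_H\subset S_H(U\cap H)$. Let $X$ be the graph with vertex set $G/U$ and edges $\{gU,gsU\}$ ($g\in G$, $s\in S$, $gU\neq gsU$). For $H\in\mathcal H$ and a left coset $tH$, let $Y_{tH}$ be the full subgraph of $X$ on the vertices $thU$, $h\in H$. The combinatorial horoball $\mathcal B(Y)$ over a graph $Y$ has vertex set $V(Y)\times\mathbb Z_{\ge 0}$ and three kinds of edges: $(v,0)$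 to $(w,0)$ when $v,w$ are adjacent in $Y$; $(v,k)$ to $(w,k)$ when $k>0$ and $0<d_Y(v,w)\le 2^k$; and $(v,k)$ to $(v,k+1)$ for all $k\ge 0$. The augmented Cayley–Abels graph $X^h$ is obtained from $X$ by gluing on, for every $H\in\mathcal H$ and every left coset $tH$ of $H$, the horoball $\mathcal B(Y_{tH})$, with its depth-zero part identified with $Y_{tH}$. The group $G$ is hyperbolic relative to $\mathcal H$ if $X^h$ is Gromov hyperbolic, and the Bowditch boundary is then the Gromov boundary of $X^h$: the set of geodesic rays issuing from a base vertex, modulo finite Hausdorff distance, with the quotient of the topology of uniform convergence on compact sets. The assertion holds for every choice of the above data for which $X^h$ is Gromov hyperbolic and for every base vertex. -/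

import Mathlib

open scoped Pointwise

universe u v

/-! ### Gromov hyperbolicity and the Gromov boundary of a graph

A connected graph is regarded as a geodesic metric space in which every edge has length one. -/

/-- Gromov's four-point condition on the vertex set of a (connected) graph with its path metric.
Every point of the geometric realization is at distance at most `1 / 2` from a vertex, so this
is the same as Gromov hyperbolicity of the realization. -/
def SimpleGraph.IsGromovHyperbolic {V : Type v} (Γ : SimpleGraph V) : Prop :=
  ∃ δ : ℕ, ∀ x y z w : V,
    Γ.dist x y + Γ.dist z w ≤
      max (Γ.dist x z + Γ.dist y w) (Γ.dist x w + Γ.dist y z) + δ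

/-- The geodesic rays issuing from the vertex `x₀`.  An arc-length parametrized geodesic ray of the
realization issuing from a vertex is at a vertex at every integer time and is determined by
these vertices. -/
def SimpleGraph.GeodesicRay {V : Type v} (Γ : SimpleGraph V) (x₀ : V) : Type v :=
  {γ : ℕ → V // γ 0 = x₀ ∧ ∀ m n : ℕ, Γ.dist (γ m) (γ (m + n)) = n}

/-- The topology of uniform convergence on compact subsets (for rays in a graph: pointwise
convergence, the vertex set being discrete). -/
instance SimpleGraph.GeodesicRay.instTopologicalSpace {V : Type v} (Γ : SimpleGraph V) (x₀ : V) :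
    TopologicalSpace (Γ.GeodesicRay x₀) :=
  TopologicalSpace.induced Subtype.val (@Pi.topologicalSpace ℕ (fun _ => V) fun _ => ⊥)

/-- Two geodesic rays are equivalent if their images are at finite Hausdorff distance. -/
def SimpleGraph.GeodesicRay.setoid {V : Type v} (Γ : SimpleGraph V) (x₀ : V) :
    Setoid (Γ.GeodesicRay x₀) where
  r γ γ' := ∃ C : ℕ,
    (∀ m, ∃ n, Γ.edist (γ.1 m) (γ'.1 n) ≤ C) ∧ (∀ n, ∃ m, Γ.edist (γ'.1 n) (γ.1 m) ≤ C)
  iseqv :=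
    { refl := fun _ => ⟨0, fun m => ⟨m, by simp⟩, fun m => ⟨m, by simp⟩⟩
      symm := fun ⟨C, h₁, h₂⟩ => ⟨C, h₂, h₁⟩
      trans := by
        rintro α β γ ⟨C, h₁, h₂⟩ ⟨D, k₁, k₂⟩
        have key : ∀ {a b c : V} {P Q : ℕ}, Γ.edist a b ≤ P → Γ.edist b c ≤ Q →
            Γ.edist a c ≤ ((P + Q : ℕ) : ℕ∞) := fun hP hQ =>
          SimpleGraph.edist_triangle.trans (by push_cast; exact add_le_add hP hQ)
        refine ⟨C + D, fun m => ?_, fun n => ?_⟩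
        · obtain ⟨n, hn⟩ := h₁ m
          obtain ⟨p, hp⟩ := k₁ n
          exact ⟨p, key hn hp⟩
        · obtain ⟨m, hm⟩ := k₂ n
          obtain ⟨p, hp⟩ := h₂ m
          exact ⟨p, add_comm C D ▸ key hm hp⟩ }

/-- The Gromov boundary of a graph with respect to a base vertex: equivalence classes of geodesic
rays, with the quotient of the topology of uniform convergence on compact subsets. -/
def SimpleGraph.GromovBoundary {V : Type v} (Γ : SimpleGraph V) (x₀ : V) : Type v :=
  Quotient (SimpleGraph.GeodesicRay.setoid Γ x₀)

instance SimpleGraph.GromovBoundary.instTopologicalSpace {V : Type v} (Γ : SimpleGraph V)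
    (x₀ : V) : TopologicalSpace (Γ.GromovBoundary x₀) :=
  inferInstanceAs (TopologicalSpace (Quotient (SimpleGraph.GeodesicRay.setoid Γ x₀)))

/-! ### Combinatorial horoballs and augmented graphs -/

/-- The combinatorial horoball based at a graph. -/
def SimpleGraph.combinatorialHoroball {V : Type v} (Γ : SimpleGraph V) : SimpleGraph (V × ℕ) :=
  SimpleGraph.fromRel fun p q =>
    (p.2 = 0 ∧ q.2 = 0 ∧ Γ.Adj p.1 q.1) ∨
    (0 < p.2 ∧ q.2 = p.2 ∧ 0 < Γ.dist p.1 q.1 ∧ Γ.dist p.1 q.1 ≤ 2 ^ p.2) ∨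
    (p.1 = q.1 ∧ q.2 = p.2 + 1)

/-- Vertices of the graph obtained from a graph with vertex set `V` by gluing a horoball over each
member of the family `Y`: the vertices `Sum.inl v` of the graph, and the vertices
`Sum.inr ⟨i, y, k⟩` of depth `k + 1` in the horoball over `Y i`. -/
abbrev AugmentedVertex {V : Type v} {I : Type v} (Y : I → Set V) : Type v :=
  V ⊕ (Σ i : I, Y i × ℕ)

/-- The inclusion of the vertices of the `i`-th horoball; depth `0` is identified with `Y i`. -/
def AugmentedVertex.ofHoroball {V : Type v} {I : Type v} (Y : I → Set V) (i : I) :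
    Y i × ℕ → AugmentedVertex Y
  | (y, 0) => Sum.inl y.1
  | (y, k + 1) => Sum.inr ⟨i, y, k⟩

/-- The union of a graph `Γ` and the combinatorial horoballs over the full subgraphs spanned by the
sets `Y i`, the depth-zero part of each horoball being identified with the subgraph. -/
def SimpleGraph.augment {V : Type v} {I : Type v} (Γ : SimpleGraph V) (Y : I → Set V) :
    SimpleGraph (AugmentedVertex Y) :=
  Γ.map Sum.inl ⊔
    ⨆ i, (Γ.induce (Y i)).combinatorialHoroball.map (AugmentedVertex.ofHoroball Y i)

/-! ### Compactly generated groups, Cayley-Abels graphs and rough ends -/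

/-- The subgroup `H` is algebraically generated by a compact subset.  A subset of `H` is compact
for the topology of `H` if and only if it is so for that of `G`; the group `G` itself is the case
`H = ⊤`. -/
def Subgroup.IsCompactlyGen {G : Type u} [Group G] [TopologicalSpace G] (H : Subgroup G) : Prop :=
  ∃ K : Set G, IsCompact K ∧ Subgroup.closure K = H

/-- `Γ` is a Cayley-Abels graph of the topological group `G`. -/
structure IsCayleyAbelsGraph (G : Type u) [Group G] [TopologicalSpace G] {V : Type v}
    [MulAction G V] (Γ : SimpleGraph V) : Prop where
  connected : Γ.Connected
  locallyFinite : ∀ x : V, (Γ.neighborSet x).Finite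
  smul_adj : ∀ (g : G) (x y : V), Γ.Adj x y → Γ.Adj (g • x) (g • y)
  transitive : ∀ x y : V, ∃ g : G, g • x = y
  stabilizer_isOpen : ∀ x : V, IsOpen (MulAction.stabilizer G x : Set G)
  stabilizer_isCompact : ∀ x : V, IsCompact (MulAction.stabilizer G x : Set G)

/-- `G` has exactly one rough end: the end space of a Cayley-Abels graph of `G` is a single point.
The vertex set of a Cayley-Abels graph is in bijection with the cosets of a vertex stabilizer, so
the universe of `G` is large enough. -/
def HasOneRoughEnd (G : Type u) [Group G] [TopologicalSpace G] : Prop :=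
  ∃ (V : Type u) (_ : MulAction G V) (Γ : SimpleGraph V),
    IsCayleyAbelsGraph G Γ ∧ ∃! e, e ∈ Γ.end

/-! ### Relatively hyperbolic groups and the Bowditch boundary -/

/-- `(G, 𝓗)` is a proper pair: `𝓗` is a finite collection of open subgroups of `G`, and no two
distinct non-compact members of `𝓗` are conjugate in `G`. -/
structure IsProperPair {G : Type u} [Group G] [TopologicalSpace G] (𝓗 : Set (Subgroup G)) :
    Prop where
  finite : 𝓗.Finite
  isOpen : ∀ H ∈ 𝓗, IsOpen (H : Set G)
  not_conj : ∀ H ∈ 𝓗, ∀ L ∈ 𝓗, H ≠ L → ¬ IsCompact (H : Set G) → ¬ IsCompact (L : Set G) →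
    ∀ g : G, H.map (MulAut.conj g).toMonoidHom ≠ L

/-- The choices from which an augmented Cayley-Abels graph of `G` with respect to `𝓗` is built:
a compact open subgroup `U`, compact generating sets `K` of `G` and `KH H` of each `H ∈ 𝓗`, and
finite symmetric sets `S` and `SH H ⊆ H ∩ S` containing the identity, with `K ⊆ S U` and
`KH H ⊆ SH H (U ∩ H)`. -/
structure CayleyAbelsData {G : Type u} [Group G] [TopologicalSpace G] (𝓗 : Set (Subgroup G)) where
  U : Subgroup G
  U_isOpen : IsOpen (U : Set G)
  U_isCompact : IsCompact (U : Set G)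
  K : Set G
  K_isCompact : IsCompact K
  closure_K : Subgroup.closure K = ⊤
  S : Set G
  S_finite : S.Finite
  S_symm : S⁻¹ = S
  one_mem_S : 1 ∈ S
  K_subset : K ⊆ S * (U : Set G)
  KH : 𝓗 → Set G
  KH_isCompact : ∀ H, IsCompact (KH H)
  closure_KH : ∀ H, Subgroup.closure (KH H) = H.1
  SH : 𝓗 → Set G
  SH_finite : ∀ H, (SH H).Finite
  SH_symm : ∀ H, (SH H)⁻¹ = SH H
  one_mem_SH : ∀ H, 1 ∈ SH H
  SH_subset : ∀ H, SH H ⊆ (H.1 : Set G)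
  SH_subset_S : ∀ H, SH H ⊆ S
  KH_subset : ∀ H, KH H ⊆ SH H * ((U ⊓ H.1 : Subgroup G) : Set G)

namespace CayleyAbelsData

variable {G : Type u} [Group G] [TopologicalSpace G] {𝓗 : Set (Subgroup G)}

/-- The Cayley-Abels graph `X` of `G`: its vertices are the left cosets of `U` and its edges are the
pairs `{gU, gsU}` with `g ∈ G` and `s ∈ S`. -/
def graph (D : CayleyAbelsData 𝓗) : SimpleGraph (G ⧸ D.U) :=
  SimpleGraph.fromRel fun x y => ∃ g : G, ∃ s ∈ D.S,
    x = (QuotientGroup.mk g : G ⧸ D.U) ∧ y = (QuotientGroup.mk (g * s) : G ⧸ D.U)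

/-- The left cosets `tH` of the members of `𝓗`; they index the horoballs. -/
abbrev PeripheralCoset (𝓗 : Set (Subgroup G)) : Type u :=
  Σ H : 𝓗, G ⧸ (H : Subgroup G)

/-- For a left coset `tH`, the set `{thU : h ∈ H}` of vertices of `X`. -/
def cosetVertices (D : CayleyAbelsData 𝓗) (c : PeripheralCoset 𝓗) : Set (G ⧸ D.U) :=
  {x | ∃ g : G, (QuotientGroup.mk g : G ⧸ (c.1 : Subgroup G)) = c.2 ∧
    (QuotientGroup.mk g : G ⧸ D.U) = x}

/-- The vertex set of the augmented Cayley-Abels graph. -/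
abbrev Vertex (D : CayleyAbelsData 𝓗) : Type u := AugmentedVertex D.cosetVertices

/-- The augmented Cayley-Abels graph `X^h` of `G` with respect to `𝓗`. -/
def augmentedGraph (D : CayleyAbelsData 𝓗) : SimpleGraph D.Vertex :=
  D.graph.augment D.cosetVertices

/-- `G` is hyperbolic relative to `𝓗`: `(G, 𝓗)` is a proper pair and the augmented Cayley-Abels
graph is Gromov hyperbolic. -/
def IsRelativelyHyperbolic (D : CayleyAbelsData 𝓗) : Prop :=
  IsProperPair 𝓗 ∧ D.augmentedGraph.IsGromovHyperbolic

/-- The Bowditch boundary of `G` with respect to `𝓗`: the Gromov boundary of the augmented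
Cayley-Abels graph, formed with geodesic rays from the vertex `x₀`. -/
abbrev BowditchBoundary (D : CayleyAbelsData 𝓗) (x₀ : D.Vertex) : Type u :=
  D.augmentedGraph.GromovBoundary x₀

end CayleyAbelsData

/-! Suppose a clopen set A splits the boundary of the proper hyperbolic graph X^h. By compactness,
Gromov products between rays in A and rays outside A are bounded (`exists_bound`). Given such a pair
of rays, any vertex of X can be taken for their origin up to an isometry, and hyperbolicity then
puts that vertex at bounded distance from a ray issuing from the base point (`exists_ray_near`). Let
P and Q be the sets of vertices of X close to rays in A and outside A. They cover X, and a vertex of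
P that is equal or adjacent to one of Q lies in a fixed ball, so P has finite boundary and P ∩ Q is
finite. As X has one end, P or Q is finite. Both are infinite, because every ray is approached by
infinitely many vertices of X (`infinite_setOf_le_gromovProd`). Either the ray returns to X
infinitely often, or it stays in one horoball and the vertices of the underlying coset, infinite in
number since H is not compact, converge to its endpoint. It remains that one-endedness passes from
one Cayley–Abels graph to another (`infinite_and_finite_or_finite_compl`) and that G acts on X^h by
isometries. -/

/-! ### Coarse geometry of graphs -/

/-- A graph all of whose metric balls are finite. -/
def SimpleGraph.IsProper {W : Type v} (Γ : SimpleGraph W) : Prop :=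
  ∀ (x : W) (n : ℕ), {y | Γ.dist x y ≤ n}.Finite

/-- The restriction of `c` to `[0, L]` is a geodesic. -/
def SimpleGraph.IsGeodesicOn {W : Type v} (Γ : SimpleGraph W) (c : ℕ → W) (L : ℕ) : Prop :=
  ∀ m n : ℕ, m + n ≤ L → Γ.dist (c m) (c (m + n)) = n

namespace SimpleGraph

open Filter

variable {W : Type v} {Γ : SimpleGraph W}

lemma Connected.isProper (hc : Γ.Connected) (hf : ∀ x, (Γ.neighborSet x).Finite) :
    Γ.IsProper := by
  intro x n
  induction n with
  | zero =>
    refine (Set.finite_singleton x).subset fun y hy => ?_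
    have : Γ.dist x y = 0 := by simpa using hy
    exact ((hc.dist_eq_zero_iff).1 this).symm
  | succ n ih =>
    refine (ih.union (ih.biUnion fun y _ => hf y)).subset fun y hy => ?_
    by_cases h : Γ.dist x y ≤ n
    · exact Or.inl h
    right
    obtain ⟨p, hp⟩ := hc.exists_walk_length_eq_dist x y
    have hy' : Γ.dist x y ≤ n + 1 := hy
    have hlen : p.length = n + 1 := by omega
    simp only [Set.mem_iUnion]
    refine ⟨p.getVert n, ?_, ?_⟩
    · have := dist_le (p.take n)
      have h2 : (p.take n).length ≤ n := by rw [Walk.take_length]; omega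
      exact this.trans h2
    · have := p.adj_getVert_succ (i := n) (by omega)
      rwa [← hlen, p.getVert_length] at this

lemma IsGeodesicOn.mono {c : ℕ → W} {L M : ℕ} (h : Γ.IsGeodesicOn c L) (hM : M ≤ L) :
    Γ.IsGeodesicOn c M := fun m n hmn => h m n (hmn.trans hM)

lemma Connected.dist_le_of_adj_succ (hc : Γ.Connected) {c : ℕ → W} {L : ℕ}
    (h : ∀ i < L, Γ.dist (c i) (c (i + 1)) ≤ 1) (m n : ℕ) (hmn : m + n ≤ L) :
    Γ.dist (c m) (c (m + n)) ≤ n := by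
  induction n with
  | zero => simp
  | succ n ih =>
    have h1 := ih (by omega)
    have h2 := h (m + n) (by omega)
    have h3 := hc.dist_triangle (u := c m) (v := c (m + n)) (w := c (m + n + 1))
    rw [← add_assoc]
    omega

lemma Connected.exists_geodesic (hc : Γ.Connected) (x y : W) :
    ∃ c : ℕ → W, c 0 = x ∧ c (Γ.dist x y) = y ∧ Γ.IsGeodesicOn c (Γ.dist x y) := by
  obtain ⟨p, hp⟩ := hc.exists_walk_length_eq_dist x y
  refine ⟨p.getVert, by simp, by rw [← hp]; simp, ?_⟩
  have hadj : ∀ i < Γ.dist x y, Γ.dist (p.getVert i) (p.getVert (i + 1)) ≤ 1 := fun i hi =>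
    (dist_eq_one_iff_adj.2 (p.adj_getVert_succ (by omega))).le
  have key := hc.dist_le_of_adj_succ hadj
  intro m n hmn
  have h1 := key 0 m (by omega)
  have h2 := key m n hmn
  have h3 := key (m + n) (Γ.dist x y - (m + n)) (by omega)
  rw [show m + n + (Γ.dist x y - (m + n)) = Γ.dist x y by omega] at h3
  have e0 : p.getVert 0 = x := by simp
  have e1 : p.getVert (Γ.dist x y) = y := by rw [← hp]; simp
  rw [zero_add, e0] at h1
  rw [e1] at h3
  have h4 := hc.dist_triangle (u := x) (v := p.getVert m) (w := y)
  have h5 := hc.dist_triangle (u := p.getVert m) (v := p.getVert (m + n)) (w := y)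
  omega

/-- The four-point condition, with a fixed constant. -/
def FourPoint (Γ : SimpleGraph W) (δ : ℕ) : Prop :=
  ∀ x y z w : W, Γ.dist x y + Γ.dist z w ≤
    max (Γ.dist x z + Γ.dist y w) (Γ.dist x w + Γ.dist y z) + δ

/-- Twice the Gromov product of `x` and `y` with respect to `o`. -/
noncomputable def gromovProd (Γ : SimpleGraph W) (o x y : W) : ℤ :=
  (Γ.dist o x : ℤ) + Γ.dist o y - Γ.dist x y

lemma gromovProd_comm (o x y : W) : Γ.gromovProd o x y = Γ.gromovProd o y x := by
  simp only [gromovProd, Γ.dist_comm (u := x) (v := y)]; ring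

/-- Take `o` as fourth point and subtract both sides from the sum of the distances from `o` to `x`,
`y`, `z`. The product being doubled, the error is exactly `δ`. -/
lemma FourPoint.min_le {δ : ℕ} (h : Γ.FourPoint δ) (o x y z : W) :
    min (Γ.gromovProd o x z) (Γ.gromovProd o z y) ≤ Γ.gromovProd o x y + δ := by
  have := h x y z o
  simp only [gromovProd]
  rw [Γ.dist_comm (u := z) (v := o), Γ.dist_comm (u := y) (v := o),
    Γ.dist_comm (u := x) (v := o), Γ.dist_comm (u := y) (v := z)] at this
  omega

lemma Connected.gromovProd_le_left (hc : Γ.Connected) (o x y : W) :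
    Γ.gromovProd o x y ≤ 2 * Γ.dist o x := by
  have := hc.dist_triangle (u := o) (v := x) (w := y)
  simp only [gromovProd]; omega

lemma Connected.gromovProd_le_right (hc : Γ.Connected) (o x y : W) :
    Γ.gromovProd o x y ≤ 2 * Γ.dist o y := by
  rw [gromovProd_comm]; exact hc.gromovProd_le_left o y x

lemma Connected.gromovProd_close (hc : Γ.Connected) (o x x' y : W) :
    Γ.gromovProd o x y ≤ Γ.gromovProd o x' y + 2 * Γ.dist x x' := by
  have h1 := hc.dist_triangle (u := o) (v := x') (w := x)
  have h2 := hc.dist_triangle (u := x') (v := x) (w := y)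
  rw [Γ.dist_comm (u := x') (v := x)] at *
  simp only [gromovProd]; omega

/-- A geodesic contains a point whose distance to `o` is controlled by the Gromov product
of its endpoints. -/
lemma FourPoint.exists_near {δ : ℕ} (h : Γ.FourPoint δ) (hc : Γ.Connected) {c : ℕ → W} {L : ℕ}
    (hg : Γ.IsGeodesicOn c L) (o : W) :
    ∃ s ≤ L, 2 * (Γ.dist o (c s) : ℤ) ≤ Γ.gromovProd o (c 0) (c L) + 2 * δ + 1 := by
  have hL : Γ.dist (c 0) (c L) = L := by simpa using hg 0 L (by omega)
  have t1 := hc.dist_triangle (u := o) (v := c L) (w := c 0)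
  have t2 := hc.dist_triangle (u := o) (v := c 0) (w := c L)
  rw [Γ.dist_comm (u := c L) (v := c 0)] at t1
  -- This is the branch point of the comparison tripod, which balances the two terms of the maximum
  -- below. By `t1` and `t2`, `s ≤ L` and the subtraction does not truncate; rounding costs the `+
  -- 1`.
  obtain ⟨s, hs⟩ : ∃ s, s = (Γ.dist o (c 0) + L - Γ.dist o (c L)) / 2 := ⟨_, rfl⟩
  have hsL : s ≤ L := by omega
  have g1 : Γ.dist (c 0) (c s) = s := by simpa using hg 0 s (by omega)
  have g2 : Γ.dist (c s) (c L) = L - s := by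
    simpa [Nat.add_sub_cancel' hsL] using hg s (L - s) (by omega)
  refine ⟨s, hsL, ?_⟩
  have := h o (c s) (c 0) (c L)
  rw [Γ.dist_comm (u := c s) (v := c 0)] at this
  simp only [gromovProd]
  omega

/-- The limit of a sequence of longer and longer geodesics, along an ultrafilter. -/
lemma IsProper.exists_limit (hp : Γ.IsProper) {o : W} (F : Ultrafilter ℕ) (c : ℕ → ℕ → W)
    (h0 : ∀ n, c n 0 = o) (hg : ∀ t, ∀ᶠ n in F, Γ.IsGeodesicOn (c n) t) :
    ∃ a : Γ.GeodesicRay o, ∀ t, ∀ᶠ n in F, c n t = a.1 t := by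
  have key : ∀ t, ∃ w, ∀ᶠ n in F, c n t = w := by
    intro t
    have h1 : ∀ᶠ n in (F : Filter ℕ), ∃ w ∈ {y | Γ.dist o y ≤ t}, c n t = w := by
      filter_upwards [hg t] with n hn
      refine ⟨_, ?_, rfl⟩
      have := hn 0 t (by omega)
      rw [h0, zero_add] at this
      exact this.le
    -- Balls are finite, so the ultrafilter selects one value of `c n t`; this replaces a diagonal
    -- argument.
    obtain ⟨w, -, hw⟩ := (Ultrafilter.eventually_exists_mem_iff (hp o t)).1 h1
    exact ⟨w, hw⟩
  choose a ha using key
  refine ⟨⟨a, ?_, fun m n => ?_⟩, ha⟩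
  · obtain ⟨n, hn⟩ := (ha 0).exists
    rw [← hn, h0]
  · obtain ⟨k, h1, h2, h3⟩ := ((ha m).and ((ha (m + n)).and (hg (m + n)))).exists
    rw [← h1, ← h2]
    exact h3 m n le_rfl

/-! ### Geodesic rays from a common vertex -/

lemma GeodesicRay.dist_zero {o : W} (a : Γ.GeodesicRay o) (n : ℕ) : Γ.dist o (a.1 n) = n := by
  have := a.2.2 0 n
  rwa [a.2.1, zero_add] at this

lemma GeodesicRay.isGeodesicOn {o : W} (a : Γ.GeodesicRay o) (L : ℕ) :
    Γ.IsGeodesicOn a.1 L := fun m n _ => a.2.2 m n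

lemma GeodesicRay.injective {o : W} (a : Γ.GeodesicRay o) : Function.Injective a.1 := by
  intro m n h
  have h1 := a.dist_zero m
  rw [h, a.dist_zero n] at h1
  exact h1.symm

lemma GeodesicRay.gromovProd_self {o : W} (a : Γ.GeodesicRay o) {m n : ℕ} (h : m ≤ n) :
    Γ.gromovProd o (a.1 m) (a.1 n) = 2 * m := by
  have h1 := a.2.2 m (n - m)
  rw [Nat.add_sub_cancel' h] at h1
  simp only [gromovProd, a.dist_zero, h1]
  omega

/-- Rays with a large Gromov product are close to each other for a long time. -/
lemma FourPoint.dist_ray_le {δ : ℕ} (h : Γ.FourPoint δ) (hc : Γ.Connected) {o : W}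
    (a b : Γ.GeodesicRay o) {m n t : ℕ} (ht : 2 * (t : ℤ) ≤ Γ.gromovProd o (a.1 m) (b.1 n)) :
    Γ.dist (a.1 t) (b.1 t) ≤ 2 * δ := by
  have h1 := hc.gromovProd_le_left o (a.1 m) (b.1 n)
  have h2 := hc.gromovProd_le_right o (a.1 m) (b.1 n)
  rw [GeodesicRay.dist_zero] at h1 h2
  have h3 := a.gromovProd_self (m := t) (n := m) (by omega)
  have h4 := b.gromovProd_self (m := t) (n := n) (by omega)
  -- Along the chain `a t`, `a m`, `b n`, `b t` consecutive products are at least `2t`; two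
  -- applications lose `2δ`.
  have h5 := h.min_le o (a.1 t) (b.1 n) (a.1 m)
  have h6 := h.min_le o (a.1 t) (b.1 t) (b.1 n)
  rw [gromovProd_comm o (b.1 n) (b.1 t)] at h6
  have h7 : Γ.gromovProd o (a.1 t) (b.1 t) = t + t - Γ.dist (a.1 t) (b.1 t) := by
    simp only [gromovProd, GeodesicRay.dist_zero]
  omega

lemma GeodesicRay.equiv_of_dist_le (hc : Γ.Connected) {o : W} (a b : Γ.GeodesicRay o) {C : ℕ}
    (h : ∀ t, Γ.dist (a.1 t) (b.1 t) ≤ C) : (GeodesicRay.setoid Γ o).r a b := by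
  refine ⟨C, fun m => ⟨m, ?_⟩, fun m => ⟨m, ?_⟩⟩
  · rw [← (hc (a.1 m) (b.1 m)).coe_dist_eq_edist]
    exact_mod_cast h m
  · rw [edist_comm, ← (hc (a.1 m) (b.1 m)).coe_dist_eq_edist]
    exact_mod_cast h m

lemma GeodesicRay.tendsto_of_eventually_eq {o : W} {ι : Type*} {F : Filter ι}
    (c : ι → Γ.GeodesicRay o)
    (a : Γ.GeodesicRay o) (h : ∀ t, ∀ᶠ n in F, (c n).1 t = a.1 t) :
    Tendsto c F (nhds a) := by
  let _ : TopologicalSpace W := ⊥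
  have : DiscreteTopology W := ⟨rfl⟩
  have hi : Topology.IsInducing (fun r : Γ.GeodesicRay o => r.1) := ⟨rfl⟩
  refine hi.tendsto_nhds_iff.2 (tendsto_pi_nhds.2 fun t => ?_)
  rw [nhds_discrete, tendsto_pure]
  exact h t

/-- Rays representing points of complementary clopen subsets of the boundary have uniformly
bounded Gromov products. -/
lemma FourPoint.exists_bound {δ : ℕ} (h : Γ.FourPoint δ) (hc : Γ.Connected) (hp : Γ.IsProper)
    {o : W} {A : Set (Γ.GromovBoundary o)} (hA : IsClopen A) :
    ∃ N : ℕ, ∀ a b : Γ.GeodesicRay o, Quotient.mk _ a ∈ A → Quotient.mk _ b ∉ A →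
      ∀ m n, Γ.gromovProd o (a.1 m) (b.1 n) ≤ N := by
  by_contra! hcon
  choose a b ha hb m n hmn using hcon
  let F := hyperfilter ℕ
  obtain ⟨a', ha'⟩ := hp.exists_limit F (fun k => (a k).1) (fun k => (a k).2.1)
    fun t => Eventually.of_forall fun k => (a k).isGeodesicOn t
  obtain ⟨b', hb'⟩ := hp.exists_limit F (fun k => (b k).1) (fun k => (b k).2.1)
    fun t => Eventually.of_forall fun k => (b k).isGeodesicOn t
  have hq : Continuous (Quotient.mk (GeodesicRay.setoid Γ o) :
      Γ.GeodesicRay o → Γ.GromovBoundary o) := continuous_quotient_mk'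
  have hA' : Quotient.mk _ a' ∈ A :=
    hA.1.mem_of_tendsto ((hq.tendsto a').comp (GeodesicRay.tendsto_of_eventually_eq a a' ha'))
      (Eventually.of_forall ha)
  have hB' : Quotient.mk _ b' ∈ Aᶜ :=
    hA.compl.1.mem_of_tendsto
      ((hq.tendsto b').comp (GeodesicRay.tendsto_of_eventually_eq b b' hb'))
      (Eventually.of_forall hb)
  -- Since the products of `a k` and `b k` tend to infinity, the limits stay within `2δ` of each
  -- other: one boundary point would lie in `A` and in its complement.
  have hab : (GeodesicRay.setoid Γ o).r a' b' := by
    refine GeodesicRay.equiv_of_dist_le hc a' b' (C := 2 * δ) fun t => ?_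
    have hbig : ∀ᶠ k in (F : Filter ℕ), 2 * t ≤ k :=
      (Nat.hyperfilter_le_atTop) (eventually_ge_atTop (2 * t))
    obtain ⟨k, h1, h2, h3⟩ := ((ha' t).and ((hb' t).and hbig)).exists
    rw [← h1, ← h2]
    refine h.dist_ray_le hc (a k) (b k) (m := m k) (n := n k) ?_
    have := hmn k
    omega
  have heq : (Quotient.mk (GeodesicRay.setoid Γ o) a') = Quotient.mk _ b' := Quotient.sound hab
  exact hB' (heq ▸ hA')

lemma IsProper.nonempty_geodesicRay [Infinite W] (hp : Γ.IsProper) (hc : Γ.Connected) (o : W) :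
    Nonempty (Γ.GeodesicRay o) := by
  have : ∀ n : ℕ, ∃ y, n < Γ.dist o y := by
    intro n
    by_contra! hcon
    exact Set.infinite_univ ((hp o n).subset fun y _ => hcon y)
  choose y hy using this
  choose c h0 _ hg using fun n => hc.exists_geodesic o (y n)
  obtain ⟨a, -⟩ := hp.exists_limit (hyperfilter ℕ) c h0 fun t => by
    filter_upwards [Nat.hyperfilter_le_atTop (eventually_ge_atTop t)] with n hn
    exact (hg n).mono (le_trans hn (hy n).le)
  exact ⟨a⟩

/-- If there are two different boundary points, then all points of an orbit of isometries are
uniformly close to geodesic rays from `o`. -/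
lemma FourPoint.exists_ray_near {δ : ℕ} (h : Γ.FourPoint δ) (hc : Γ.Connected) (hp : Γ.IsProper)
    {o : W} {a b : Γ.GeodesicRay o} {N : ℕ} (hab : ∀ m n, Γ.gromovProd o (a.1 m) (b.1 n) ≤ N)
    (v₀ : W) : ∃ C : ℕ, ∀ φ : W → W, (∀ x y, Γ.dist (φ x) (φ y) = Γ.dist x y) →
      ∃ (r : Γ.GeodesicRay o) (s : ℕ), Γ.dist (φ v₀) (r.1 s) ≤ C := by
  refine ⟨Γ.dist o v₀ + (N + 3 * δ + 1), fun φ hφ => ?_⟩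
  suffices H : ∃ (r : Γ.GeodesicRay o) (s : ℕ), Γ.dist (φ o) (r.1 s) ≤ N + 3 * δ + 1 by
    obtain ⟨r, s, hs⟩ := H
    refine ⟨r, s, ?_⟩
    have h1 := hc.dist_triangle (u := φ v₀) (v := φ o) (w := r.1 s)
    rw [hφ, Γ.dist_comm (u := v₀)] at h1
    omega
  -- If the product of `o` and `φ (a m)` seen from `φ o` is bounded, the geodesics from `o` to `φ (a
  -- m)` pass near `φ o`, and so does their limit ray.
  have main : ∀ a : Γ.GeodesicRay o,
      (∀ᶠ m in (hyperfilter ℕ : Filter ℕ), Γ.gromovProd (φ o) o (φ (a.1 m)) ≤ N + δ) →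
      ∃ (r : Γ.GeodesicRay o) (s : ℕ), Γ.dist (φ o) (r.1 s) ≤ N + 3 * δ + 1 := by
    intro a hev
    choose c h0 h1 hg using fun m => hc.exists_geodesic o (φ (a.1 m))
    have hlen : ∀ m, m ≤ Γ.dist o (φ (a.1 m)) + Γ.dist o (φ o) := by
      intro m
      have h1 := hc.dist_triangle (u := φ o) (v := o) (w := φ (a.1 m))
      rw [hφ, a.dist_zero, Γ.dist_comm (u := φ o)] at h1
      omega
    obtain ⟨r, hr⟩ := hp.exists_limit (hyperfilter ℕ) c h0 fun t => by
      filter_upwards [Nat.hyperfilter_le_atTop (eventually_ge_atTop (t + Γ.dist o (φ o)))]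
        with n hn
      have hn' : t + Γ.dist o (φ o) ≤ n := hn
      have := hlen n
      exact (hg n).mono (by omega)
    refine ⟨r, ?_⟩
    choose s hsL hs using fun m => h.exists_near hc (hg m) (φ o)
    -- The passage times near `φ o` are bounded, hence constant along the ultrafilter, so the nearby
    -- point survives in the limit.
    have hfin : ∀ᶠ m in (hyperfilter ℕ : Filter ℕ),
        ∃ t ∈ Set.Iic (Γ.dist o (φ o) + (N + 3 * δ + 1)), s m = t := by
      filter_upwards [hev] with m hm
      refine ⟨s m, ?_, rfl⟩
      have e1 := hs m
      rw [h0, h1] at e1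
      have e2 := hg m 0 (s m) (by simpa using hsL m)
      rw [zero_add, h0] at e2
      have e3 := hc.dist_triangle (u := o) (v := φ o) (w := c m (s m))
      simp only [Set.mem_Iic]
      omega
    obtain ⟨t, -, ht⟩ := (Ultrafilter.eventually_exists_mem_iff (Set.finite_Iic _)).1 hfin
    obtain ⟨m, hm1, hm2, hm3⟩ := (hev.and (ht.and (hr t))).exists
    refine ⟨t, ?_⟩
    have e1 := hs m
    rw [h0, h1, hm2, hm3] at e1
    omega
  -- Seen from `φ o`, the points `φ (a m)` and `φ (b m)` have product at most `N`, so `o` cannot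
  -- have a large product with both.
  have hor : ∀ᶠ m in (hyperfilter ℕ : Filter ℕ), Γ.gromovProd (φ o) o (φ (a.1 m)) ≤ N + δ ∨
      Γ.gromovProd (φ o) o (φ (b.1 m)) ≤ N + δ := by
    refine Eventually.of_forall fun m => ?_
    have h1 := h.min_le (φ o) (φ (a.1 m)) (φ (b.1 m)) o
    have h2 : Γ.gromovProd (φ o) (φ (a.1 m)) (φ (b.1 m)) ≤ N := by
      have := hab m m
      simpa only [gromovProd, hφ] using this
    rw [gromovProd_comm _ _ o] at h1
    omega
  rcases Ultrafilter.eventually_or.1 hor with h1 | h1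
  · exact main a h1
  · exact main b h1

/-- A criterion for the connectedness of the Gromov boundary of a proper hyperbolic graph, in
terms of a one-ended graph `X` that is mapped to it. -/
theorem gromovBoundary_connectedSpace {V : Type*} (X : SimpleGraph V) (ι : V → W)
    (hh : Γ.IsGromovHyperbolic) (hc : Γ.Connected) (hp : Γ.IsProper) (o : W) (v₀ : V) [Infinite V]
    (hι : Function.Injective ι) (hadj : ∀ v w, X.Adj v w → Γ.dist (ι v) (ι w) ≤ 1)
    (htrans : ∀ v, ∃ φ : W → W, (∀ x y, Γ.dist (φ x) (φ y) = Γ.dist x y) ∧ φ (ι v₀) = ι v)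
    (hend : ∀ P : Set V, {v | v ∈ P ∧ ∃ w, w ∉ P ∧ X.Adj v w}.Finite → P.Finite ∨ Pᶜ.Finite)
    (hray : ∀ (a : Γ.GeodesicRay o) (R : ℕ),
      {v | ∃ m, (R : ℤ) ≤ Γ.gromovProd o (ι v) (a.1 m)}.Infinite) :
    ConnectedSpace (Γ.GromovBoundary o) := by
  obtain ⟨δ, h⟩ := hh
  have h : Γ.FourPoint δ := h
  have : Infinite W := Infinite.of_injective ι hι
  obtain ⟨r₀⟩ := hp.nonempty_geodesicRay hc o
  have : Nonempty (Γ.GromovBoundary o) := ⟨Quotient.mk _ r₀⟩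
  have hpre : PreconnectedSpace (Γ.GromovBoundary o) := by
    rw [preconnectedSpace_iff_clopen]
    by_contra! hcon
    obtain ⟨A, hA, hne, hnu⟩ := hcon
    obtain ⟨N, hN⟩ := h.exists_bound hc hp hA
    obtain ⟨a, ha⟩ : ∃ a : Γ.GeodesicRay o, Quotient.mk _ a ∈ A := by
      obtain ⟨x, hx⟩ := hne
      obtain ⟨a, rfl⟩ := Quotient.exists_rep x
      exact ⟨a, hx⟩
    obtain ⟨b, hb⟩ : ∃ a : Γ.GeodesicRay o, Quotient.mk _ a ∉ A := by
      obtain ⟨x, hx⟩ := (Set.ne_univ_iff_exists_notMem A).1 hnu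
      obtain ⟨a, rfl⟩ := Quotient.exists_rep x
      exact ⟨a, hx⟩
    obtain ⟨C, hC⟩ := h.exists_ray_near hc hp (hN a b ha hb) (ι v₀)
    have hnear : ∀ v, ∃ (r : Γ.GeodesicRay o) (s : ℕ), Γ.dist (ι v) (r.1 s) ≤ C := by
      intro v
      obtain ⟨φ, hφ, hv⟩ := htrans v
      rw [← hv]
      exact hC φ hφ
    let P : Set V := {v | ∃ r : Γ.GeodesicRay o, Quotient.mk _ r ∈ A ∧
      ∃ s, Γ.dist (ι v) (r.1 s) ≤ C}
    let Q : Set V := {v | ∃ r : Γ.GeodesicRay o, Quotient.mk _ r ∉ A ∧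
      ∃ s, Γ.dist (ι v) (r.1 s) ≤ C}
    have hPQ : ∀ v, v ∈ P ∨ v ∈ Q := by
      intro v
      obtain ⟨r, s, hs⟩ := hnear v
      by_cases hr : Quotient.mk _ r ∈ A
      · exact Or.inl ⟨r, hr, s, hs⟩
      · exact Or.inr ⟨r, hr, s, hs⟩
    -- Stated for arbitrary sets of rays because it is applied to both sides of the partition.
    have hinf : ∀ P' Q' : Set (Γ.GeodesicRay o),
        (∀ v, (∃ r ∈ P', ∃ s, Γ.dist (ι v) (r.1 s) ≤ C) ∨
          ∃ r ∈ Q', ∃ s, Γ.dist (ι v) (r.1 s) ≤ C) →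
        (∀ a ∈ P', ∀ b ∈ Q', ∀ m n, Γ.gromovProd o (a.1 m) (b.1 n) ≤ N) →
        P'.Nonempty → {v | ∃ r ∈ P', ∃ s, Γ.dist (ι v) (r.1 s) ≤ C}.Infinite := by
      rintro P' Q' hcov hN' ⟨a, ha⟩
      -- A vertex within `C` of a ray in `Q'` has product at most `N + 2 * C` with points of `a`.
      refine (hray a (N + 2 * C + 1)).mono ?_
      rintro v ⟨m, hm⟩
      rcases hcov v with hv | ⟨b, hb, s, hs⟩
      · exact hv
      exfalso
      have h1 := hN' a ha b hb m s
      rw [gromovProd_comm] at h1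
      have h2 := hc.gromovProd_close o (ι v) (b.1 s) (a.1 m)
      push_cast at hm
      omega
    have hPinf : P.Infinite := by
      refine hinf {r | Quotient.mk _ r ∈ A} {r | Quotient.mk _ r ∉ A} hPQ
        (fun a ha b hb => hN a b ha hb) ⟨a, ha⟩
    have hQinf : Q.Infinite := by
      refine hinf {r | Quotient.mk _ r ∉ A} {r | Quotient.mk _ r ∈ A} (fun v => (hPQ v).symm)
        (fun a ha b hb m n => ?_) ⟨b, hb⟩
      rw [gromovProd_comm]
      exact hN b a hb ha n m
    -- Moving each of `v`, `w` to its ray costs `2 * C`, so their product is at most `N + 4 * C`; it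
    -- is also at least `2 d(o, v) - 2`. The case `v = w` bounds the overlap of `P` and `Q`.
    have hfar : ∀ v w, v ∈ P → w ∈ Q → Γ.dist (ι v) (ι w) ≤ 1 →
        Γ.dist o (ι v) ≤ N + 4 * C + 2 := by
      rintro v w ⟨r, hr, s, hs⟩ ⟨r', hr', s', hs'⟩ hvw
      have h1 := hN r r' hr hr' s s'
      have h2 := hc.gromovProd_close o (ι v) (r.1 s) (r'.1 s')
      have h3 := hc.gromovProd_close o (ι w) (r'.1 s') (ι v)
      rw [gromovProd_comm o (r'.1 s')] at h3
      have h4 : Γ.gromovProd o (ι w) (ι v) =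
        (Γ.dist o (ι w) : ℤ) + Γ.dist o (ι v) - Γ.dist (ι w) (ι v) := rfl
      rw [Γ.dist_comm (u := ι w) (v := ι v)] at h4
      have h5 := hc.dist_triangle (u := o) (v := ι w) (w := ι v)
      rw [Γ.dist_comm (u := ι w) (v := ι v)] at h5
      omega
    have hballfin : {v | Γ.dist o (ι v) ≤ N + 4 * C + 2}.Finite :=
      (hp o (N + 4 * C + 2)).preimage hι.injOn
    have hbd : {v | v ∈ P ∧ ∃ w, w ∉ P ∧ X.Adj v w}.Finite := by
      refine hballfin.subset ?_
      rintro v ⟨hv, w, hw, hvw⟩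
      exact hfar v w hv ((hPQ w).resolve_left hw) (hadj v w hvw)
    rcases hend P hbd with hfin | hfin
    · exact hPinf hfin
    · refine hQinf ((hfin.union hballfin).subset fun v hv => ?_)
      by_cases hvP : v ∈ P
      · exact Or.inr (hfar v v hvP hv (by simp))
      · exact Or.inl hvP
  exact { toPreconnectedSpace := hpre, toNonempty := inferInstance }

end SimpleGraph

/-! ### The geometry of augmented graphs -/

namespace SimpleGraph

variable {V I : Type v} {Γ : SimpleGraph V} {Y : I → Set V}

lemma augment_adj_cases {x y : AugmentedVertex Y} (h : (Γ.augment Y).Adj x y) :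
    (∃ v w, Γ.Adj v w ∧ x = Sum.inl v ∧ y = Sum.inl w) ∨
    ∃ i p q, (Γ.induce (Y i)).combinatorialHoroball.Adj p q ∧
      x = AugmentedVertex.ofHoroball Y i p ∧ y = AugmentedVertex.ofHoroball Y i q := by
  simp only [augment, sup_adj, iSup_adj, map_adj'] at h
  rcases h with ⟨-, v, w, hvw, rfl, rfl⟩ | ⟨i, -, p, q, hpq, rfl, rfl⟩
  · exact Or.inl ⟨v, w, hvw, rfl, rfl⟩
  · exact Or.inr ⟨i, p, q, hpq, rfl, rfl⟩

lemma ofHoroball_injective (i : I) :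
    Function.Injective (AugmentedVertex.ofHoroball Y i) := by
  rintro ⟨y, _ | k⟩ ⟨y', _ | k'⟩ h
  · simpa [AugmentedVertex.ofHoroball, Subtype.ext_iff] using h
  · simp [AugmentedVertex.ofHoroball] at h
  · simp [AugmentedVertex.ofHoroball] at h
  · simpa [AugmentedVertex.ofHoroball] using h

lemma augment_adj_inl {v w : V} (h : Γ.Adj v w) :
    (Γ.augment Y).Adj (Sum.inl v) (Sum.inl w) :=
  Or.inl ⟨by simpa using h.ne, v, w, h, rfl, rfl⟩

lemma augment_adj_ofHoroball {i : I} {p q : Y i × ℕ}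
    (h : (Γ.induce (Y i)).combinatorialHoroball.Adj p q) :
    (Γ.augment Y).Adj (AugmentedVertex.ofHoroball Y i p)
      (AugmentedVertex.ofHoroball Y i q) := by
  refine Or.inr ?_
  rw [iSup_adj]
  exact ⟨i, (ofHoroball_injective i).ne h.ne, p, q, h, rfl, rfl⟩

lemma augment_adj_vertical (i : I) (y : Y i) (k : ℕ) :
    (Γ.augment Y).Adj (AugmentedVertex.ofHoroball Y i (y, k))
      (AugmentedVertex.ofHoroball Y i (y, k + 1)) := by
  refine augment_adj_ofHoroball ?_
  rw [combinatorialHoroball, fromRel_adj]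
  exact ⟨by simp, Or.inl (Or.inr (Or.inr ⟨rfl, rfl⟩))⟩

lemma augment_adj_horizontal (i : I) {y y' : Y i} {k : ℕ} (hk : 0 < k)
    (h0 : 0 < (Γ.induce (Y i)).dist y y') (h1 : (Γ.induce (Y i)).dist y y' ≤ 2 ^ k) :
    (Γ.augment Y).Adj (AugmentedVertex.ofHoroball Y i (y, k))
      (AugmentedVertex.ofHoroball Y i (y', k)) := by
  refine augment_adj_ofHoroball ?_
  rw [combinatorialHoroball, fromRel_adj]
  refine ⟨fun h => ?_, Or.inl (Or.inr (Or.inl ⟨hk, rfl, h0, h1⟩))⟩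
  have : y = y' := congrArg Prod.fst h
  simp [this] at h0

/-- Adjacency in a combinatorial horoball. -/
lemma combinatorialHoroball_adj_cases {W : Type*} {Δ : SimpleGraph W} {p q : W × ℕ}
    (h : Δ.combinatorialHoroball.Adj p q) :
    (p.2 = 0 ∧ q.2 = 0 ∧ Δ.Adj p.1 q.1) ∨
    (0 < p.2 ∧ q.2 = p.2 ∧ 0 < Δ.dist p.1 q.1 ∧ Δ.dist p.1 q.1 ≤ 2 ^ p.2) ∨
    (p.1 = q.1 ∧ q.2 = p.2 + 1) ∨ (p.1 = q.1 ∧ p.2 = q.2 + 1) := by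
  rw [combinatorialHoroball, fromRel_adj] at h
  rcases h with ⟨-, (h | h | h) | (h | h | h)⟩
  · exact Or.inl h
  · exact Or.inr (Or.inl h)
  · exact Or.inr (Or.inr (Or.inl h))
  · exact Or.inl ⟨h.2.1, h.1, h.2.2.symm⟩
  · refine Or.inr (Or.inl ⟨h.2.1 ▸ h.1, h.2.1.symm, ?_⟩)
    rw [dist_comm, h.2.1]
    exact h.2.2
  · exact Or.inr (Or.inr (Or.inr ⟨h.1.symm, h.2⟩))

lemma augment_connected (hΓ : Γ.Connected) : (Γ.augment Y).Connected := by
  have hV : ∀ v w, (Γ.augment Y).Reachable (Sum.inl v) (Sum.inl w) := by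
    intro v w
    let f : Γ →g Γ.augment Y := ⟨Sum.inl, fun h => augment_adj_inl h⟩
    exact (hΓ v w).map f
  have hor : ∀ i y k, (Γ.augment Y).Reachable (AugmentedVertex.ofHoroball Y i (y, k))
      (Sum.inl y.1) := by
    intro i y k
    induction k with
    | zero => exact Reachable.refl _
    | succ k ih => exact (augment_adj_vertical i y k).symm.reachable.trans ih
  have hall : ∀ x : AugmentedVertex Y, ∃ v, (Γ.augment Y).Reachable x (Sum.inl v) := by
    rintro (v | ⟨i, y, k⟩)
    · exact ⟨v, Reachable.refl _⟩
    · exact ⟨_, hor i y (k + 1)⟩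
  obtain ⟨v₀⟩ := hΓ.nonempty
  have : Nonempty (AugmentedVertex Y) := ⟨Sum.inl v₀⟩
  refine ⟨fun x y => ?_⟩
  obtain ⟨v, hv⟩ := hall x
  obtain ⟨w, hw⟩ := hall y
  exact hv.trans ((hV v w).trans hw.symm)

/-- Horizontal neighbours lie in a ball of `Y i`, finite by properness; `hYc` is needed since `dist`
is `0` between different components. -/
lemma augment_neighborSet_finite (hf : ∀ v, (Γ.neighborSet v).Finite)
    (hY : ∀ v, {i | v ∈ Y i}.Finite) (hYc : ∀ i, (Γ.induce (Y i)).Connected)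
    (x : AugmentedVertex Y) : ((Γ.augment Y).neighborSet x).Finite := by
  have hYp : ∀ i, (Γ.induce (Y i)).IsProper := by
    refine fun i => (hYc i).isProper fun y => ?_
    exact (hf y.1).preimage (f := Subtype.val) Subtype.val_injective.injOn
  rcases x with v | ⟨i, y, k⟩
  · have : Finite {i | v ∈ Y i} := hY v
    refine (((hf v).image Sum.inl).union (Set.finite_range
      fun i : {i | v ∈ Y i} => (Sum.inr ⟨i.1, ⟨v, i.2⟩, 0⟩ : AugmentedVertex Y))).subset ?_
    intro z hz
    rcases augment_adj_cases hz with ⟨v', w, h, hv, rfl⟩ | ⟨i, ⟨p, k⟩, ⟨q, l⟩, h, hv, rfl⟩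
    · obtain rfl : v = v' := by simpa using hv
      exact Or.inl ⟨w, h, rfl⟩
    · rcases k with _ | k
      swap
      · simp [AugmentedVertex.ofHoroball] at hv
      obtain rfl : v = p.1 := by simpa [AugmentedVertex.ofHoroball] using hv
      rcases combinatorialHoroball_adj_cases h with h | h | h | h
      · obtain rfl : l = 0 := h.2.1
        exact Or.inl ⟨q.1, h.2.2, rfl⟩
      · simp at h
      · simp only [zero_add] at h
        obtain ⟨rfl, rfl⟩ := h
        exact Or.inr ⟨⟨i, p.2⟩, rfl⟩
      · simp at h
  · refine (((Set.finite_singleton (AugmentedVertex.ofHoroball Y i (y, k))).union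
      (Set.finite_singleton (AugmentedVertex.ofHoroball Y i (y, k + 2)))).union
      ((hYp i y (2 ^ (k + 1))).image
        fun q => AugmentedVertex.ofHoroball Y i (q, k + 1))).subset ?_
    intro z hz
    rcases augment_adj_cases hz with ⟨v', w, h, hv, rfl⟩ | ⟨j, ⟨p, l⟩, ⟨q, l'⟩, h, hv, rfl⟩
    · simp at hv
    rcases l with _ | l
    · simp [AugmentedVertex.ofHoroball] at hv
    obtain rfl : i = j := by
      have := Sum.inr_injective hv
      exact congrArg Sigma.fst this
    have h2 := ofHoroball_injective (Y := Y) i (a₁ := (y, k + 1)) (a₂ := (p, l + 1)) hv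
    simp only [Prod.mk.injEq, Nat.add_right_cancel_iff] at h2
    obtain ⟨rfl, rfl⟩ := h2
    rcases combinatorialHoroball_adj_cases h with h | h | h | h
    · simp at h
    · obtain rfl : l' = k + 1 := h.2.1
      exact Or.inr ⟨q, h.2.2.2, rfl⟩
    · obtain ⟨rfl, rfl⟩ : y = q ∧ l' = k + 2 := h
      exact Or.inl (Or.inr rfl)
    · simp only [Nat.add_right_cancel_iff] at h
      obtain ⟨rfl, rfl⟩ := h
      exact Or.inl (Or.inl rfl)

/-- The depth of a vertex of an augmented graph. -/
def _root_.AugmentedVertex.depth : AugmentedVertex Y → ℕ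
  | Sum.inl _ => 0
  | Sum.inr ⟨_, _, k⟩ => k + 1

@[simp] lemma depth_ofHoroball (i : I) (p : Y i × ℕ) :
    (AugmentedVertex.ofHoroball Y i p).depth = p.2 := by
  rcases p with ⟨y, _ | k⟩ <;> rfl

lemma depth_le_of_adj {x y : AugmentedVertex Y} (h : (Γ.augment Y).Adj x y) :
    y.depth ≤ x.depth + 1 := by
  rcases augment_adj_cases h with ⟨v', w, -, rfl, rfl⟩ | ⟨j, p, q, h', rfl, rfl⟩
  · simp [AugmentedVertex.depth]
  · simp only [depth_ofHoroball]
    rcases combinatorialHoroball_adj_cases h' with h | h | h | h <;> omega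

lemma depth_le_add_dist (hc : (Γ.augment Y).Connected) (x y : AugmentedVertex Y) :
    y.depth ≤ x.depth + (Γ.augment Y).dist x y := by
  obtain ⟨p, hp⟩ := hc.exists_walk_length_eq_dist x y
  rw [← hp]
  clear hp
  induction p with
  | nil => simp
  | cons h p ih =>
    have := depth_le_of_adj h
    rw [Walk.length_cons]
    omega

/-- Depth is 1-Lipschitz and grows by one along each upward edge. -/
lemma isGeodesicOn_vertical (hc : (Γ.augment Y).Connected) (i : I) (y : Y i) (k L : ℕ) :
    (Γ.augment Y).IsGeodesicOn (fun s => AugmentedVertex.ofHoroball Y i (y, k + s)) L := by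
  intro m n _
  apply le_antisymm
  · refine hc.dist_le_of_adj_succ (c := fun s => AugmentedVertex.ofHoroball Y i (y, k + s))
      (L := m + n) (fun s _ => ?_) m n le_rfl
    exact (dist_eq_one_iff_adj.2 (augment_adj_vertical i y (k + s))).le
  · have := depth_le_add_dist hc (AugmentedVertex.ofHoroball Y i (y, k + m))
      (AugmentedVertex.ofHoroball Y i (y, k + (m + n)))
    simp only [depth_ofHoroball] at this
    simp only
    omega

/-- A horoball can only be left through depth zero, so a ray that eventually avoids the original
graph is trapped in one horoball. -/
lemma same_horoball_of_adj {i : I} {p : Y i × ℕ} {z : AugmentedVertex Y}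
    (h : (Γ.augment Y).Adj (Sum.inr ⟨i, p⟩) z) (hz : ∀ v, z ≠ Sum.inl v) :
    ∃ q, z = Sum.inr ⟨i, q⟩ := by
  rcases augment_adj_cases h with ⟨v', w, h, hv, rfl⟩ | ⟨j, ⟨p, l⟩, ⟨q, l'⟩, h, hv, rfl⟩
  · simp at hv
  · rcases l with _ | l
    · simp [AugmentedVertex.ofHoroball] at hv
    obtain rfl : i = j := congrArg Sigma.fst (Sum.inr_injective hv)
    rcases l' with _ | l'
    · exact (hz _ rfl).elim
    · exact ⟨(q, l'), rfl⟩

/-- A geodesic ray that ends in a horoball is approached by the points on the horosphere. -/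
lemma infinite_setOf_le_gromovProd {δ : ℕ} (h : (Γ.augment Y).FourPoint δ)
    (hc : (Γ.augment Y).Connected) (hp : (Γ.augment Y).IsProper)
    (hYc : ∀ i, (Γ.induce (Y i)).Connected) (hYi : ∀ i, (Y i).Infinite)
    {o : AugmentedVertex Y} (a : (Γ.augment Y).GeodesicRay o) (R : ℕ) :
    {v : V | ∃ m, (R : ℤ) ≤ (Γ.augment Y).gromovProd o (Sum.inl v) (a.1 m)}.Infinite := by
  by_cases hinf : {m | ∃ v, a.1 m = Sum.inl v}.Infinite
  · intro hfin
    refine hinf (((Set.finite_lt_nat R).union ((hfin.image Sum.inl).preimage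
      (a.injective.injOn))).subset ?_)
    rintro m ⟨v, hv⟩
    by_cases hm : m < R
    · exact Or.inl hm
    refine Or.inr ⟨v, ⟨m, ?_⟩, hv.symm⟩
    rw [← hv, a.gromovProd_self le_rfl]
    omega
  obtain ⟨m₀, hm₀⟩ : ∃ m₀, ∀ m ≥ m₀, ∀ v, a.1 m ≠ Sum.inl v := by
    obtain ⟨b, hb⟩ := (Set.not_infinite.1 hinf).bddAbove
    refine ⟨b + 1, fun m hm v hv => ?_⟩
    have : m ≤ b := hb ⟨v, hv⟩
    omega
  obtain ⟨i, hi⟩ : ∃ i, ∀ m ≥ m₀, ∃ q, a.1 m = Sum.inr ⟨i, q⟩ := by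
    obtain ⟨i, q, hq⟩ : ∃ i q, a.1 m₀ = Sum.inr ⟨i, q⟩ := by
      rcases hx : a.1 m₀ with v | ⟨i, q⟩
      · exact (hm₀ m₀ le_rfl v hx).elim
      · exact ⟨i, q, rfl⟩
    refine ⟨i, fun m hm => ?_⟩
    induction m, hm using Nat.le_induction with
    | base => exact ⟨q, hq⟩
    | succ m hm ih =>
      obtain ⟨q', hq'⟩ := ih
      have hadj : (Γ.augment Y).Adj (a.1 m) (a.1 (m + 1)) :=
        dist_eq_one_iff_adj.1 (a.2.2 m 1)
      rw [hq'] at hadj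
      exact same_horoball_of_adj hadj (hm₀ _ (by omega))
  obtain ⟨R', hR'⟩ : ∃ R', R' = R + 2 * δ + 1 := ⟨_, rfl⟩
  let T : Set (Y i × ℕ) :=
    {p | (Γ.augment Y).dist o (AugmentedVertex.ofHoroball Y i p) ≤ R'}
  have hT : T.Finite := (hp o R').preimage (ofHoroball_injective i).injOn
  have hT' : (⋃ p ∈ T, (fun j => AugmentedVertex.ofHoroball Y i (p.1, j)) ''
      Set.Iic p.2).Finite := hT.biUnion fun p _ => (Set.finite_Iic _).image _
  -- Only finitely many vertices lie at or below a point of `T`. Beyond them, the whole column above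
  -- `a m` stays outside the ball of radius `R'`.
  obtain ⟨m, hm, hmT⟩ : ∃ m ≥ m₀, a.1 m ∉ ⋃ p ∈ T,
      (fun j => AugmentedVertex.ofHoroball Y i (p.1, j)) '' Set.Iic p.2 := by
    by_contra! hcon
    exact Set.Ici_infinite m₀ ((hT'.preimage a.injective.injOn).subset fun m hm => hcon m hm)
  obtain ⟨⟨z, k⟩, hz⟩ := hi m hm
  change a.1 m = AugmentedVertex.ofHoroball Y i (z, k + 1) at hz
  have hup : ∀ s, R' < (Γ.augment Y).dist o
      (AugmentedVertex.ofHoroball Y i (z, k + 1 + s)) := by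
    intro s
    by_contra! hs
    refine hmT ?_
    simp only [Set.mem_iUnion]
    exact ⟨(z, k + 1 + s), hs, k + 1, by simp, hz.symm⟩
  have hYinf : (Set.univ : Set (Y i)).Infinite := by
    have := (hYi i).to_subtype
    exact Set.infinite_univ
  refine (((hYinf.sdiff (hT.image Prod.fst))).image
    (Subtype.val_injective.injOn)).mono ?_
  rintro _ ⟨y, ⟨-, hy⟩, rfl⟩
  have hyup : ∀ s, R' < (Γ.augment Y).dist o (AugmentedVertex.ofHoroball Y i (y, s)) := by
    intro s
    by_contra! hs
    exact hy ⟨(y, s), hs, rfl⟩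
  obtain ⟨D, hD⟩ : ∃ D, D = (Γ.induce (Y i)).dist y z := ⟨_, rfl⟩
  -- Since `D ≤ 2 ^ (k + 1 + D)`, the columns over `y` and `z` are joined by an edge at this depth.
  have hadj : (Γ.augment Y).dist (AugmentedVertex.ofHoroball Y i (y, k + 1 + D))
      (AugmentedVertex.ofHoroball Y i (z, k + 1 + D)) ≤ 1 := by
    by_cases hyz : y = z
    · simp [hyz]
    refine (dist_eq_one_iff_adj.2 (augment_adj_horizontal i (by omega)
      ((hYc i).pos_dist_of_ne hyz) ?_)).le
    rw [← hD]
    exact (Nat.lt_two_pow_self).le.trans (Nat.pow_le_pow_right (by omega) (by omega))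
  refine ⟨m, ?_⟩
  -- By `exists_near`, a geodesic outside the ball of radius `R'` has endpoints with product at
  -- least `2R' + 1 - 2δ`. The chain up the column of `y`, across, and down to `a m` loses a further
  -- `2δ`, which `R'` absorbs.
  obtain ⟨s, -, hs⟩ := h.exists_near hc (isGeodesicOn_vertical hc i y 0 (k + 1 + D)) o
  obtain ⟨t, -, ht⟩ := h.exists_near hc (isGeodesicOn_vertical hc i z (k + 1) D) o
  have e1 := hyup (0 + s)
  have e2 := hup t
  have e3 := hyup (k + 1 + D)
  have e4 := hup D
  simp only [zero_add, add_zero] at hs ht e1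
  rw [← hz, gromovProd_comm] at ht
  change _ ≤ (Γ.augment Y).gromovProd o (Sum.inl y.1) _ + _ + _ at hs
  have e5 := h.min_le o (Sum.inl y.1) (AugmentedVertex.ofHoroball Y i (z, k + 1 + D))
    (AugmentedVertex.ofHoroball Y i (y, k + 1 + D))
  have e6 := h.min_le o (Sum.inl y.1) (a.1 m)
    (AugmentedVertex.ofHoroball Y i (z, k + 1 + D))
  have e7 : (Γ.augment Y).gromovProd o (AugmentedVertex.ofHoroball Y i (y, k + 1 + D))
    (AugmentedVertex.ofHoroball Y i (z, k + 1 + D)) =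
      ((Γ.augment Y).dist o (AugmentedVertex.ofHoroball Y i (y, k + 1 + D)) : ℤ) +
      (Γ.augment Y).dist o (AugmentedVertex.ofHoroball Y i (z, k + 1 + D)) -
      (Γ.augment Y).dist (AugmentedVertex.ofHoroball Y i (y, k + 1 + D))
        (AugmentedVertex.ofHoroball Y i (z, k + 1 + D)) := rfl
  omega

end SimpleGraph

/-! ### Graphs with one end -/

namespace SimpleGraph

variable {V : Type v} {Γ : SimpleGraph V}

/-- Every infinite component of the complement of a finite set contains an end. -/
lemma exists_end_of_infinite (hc : Γ.Connected) (hf : ∀ v, (Γ.neighborSet v).Finite)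
    (F : Finset V) (C : Γ.ComponentCompl F) (hC : C.supp.Infinite) :
    ∃ e ∈ Γ.end, e (Opposite.op F) = C := by
  classical
  have : Γ.LocallyFinite := fun v => (hf v).fintype
  have : Fact Γ.Preconnected := ⟨hc.preconnected⟩
  have : Infinite V := Set.infinite_univ_iff.1 (hC.mono (Set.subset_univ _))
  have hfin : ∀ K, Finite (Γ.componentComplFunctor.obj K) := fun K =>
    Γ.componentCompl_finite K.unop
  have hne : ∀ K, Nonempty (Γ.componentComplFunctor.obj K) := fun K =>
    Γ.componentCompl_nonempty_of_infinite K.unop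
  -- Finite sets form a Mittag-Leffler system, so sections surject onto each eventual range, and the
  -- infinite components are exactly those in the eventual range.
  have hML : Γ.componentComplFunctor.IsMittagLeffler :=
    Γ.componentComplFunctor.isMittagLeffler_of_exists_finite_range fun K =>
      ⟨K, CategoryTheory.CategoryStruct.id K, Set.toFinite _⟩
  have hne' := Γ.componentComplFunctor.toEventualRanges_nonempty hML
  have hsurj := Γ.componentComplFunctor.toEventualRanges.eval_section_surjective_of_surjective
    (Γ.componentComplFunctor.surjective_toEventualRanges hML) (Opposite.op F)
  obtain ⟨s, hs⟩ := hsurj ⟨C, (Γ.infinite_iff_in_eventualRange C).1 hC⟩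
  refine ⟨_, (Γ.componentComplFunctor.toEventualRangesSectionsEquiv s).2, ?_⟩
  exact congrArg Subtype.val hs

/-- In a graph with one end, a set of vertices with finite boundary is finite or cofinite. -/
lemma finite_or_finite_compl_of_end (hc : Γ.Connected) (hf : ∀ v, (Γ.neighborSet v).Finite)
    (he : ∃! e, e ∈ Γ.end) (Q : Set V) (hQ : {v | v ∈ Q ∧ ∃ w, w ∉ Q ∧ Γ.Adj v w}.Finite) :
    Q.Finite ∨ Qᶜ.Finite := by
  classical
  by_contra! hcon
  obtain ⟨h1, h2⟩ := hcon
  have : Γ.LocallyFinite := fun v => (hf v).fintype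
  have : Fact Γ.Preconnected := ⟨hc.preconnected⟩
  obtain ⟨F, hF⟩ : ∃ F : Finset V, (F : Set V) = {v | v ∈ Q ∧ ∃ w, w ∉ Q ∧ Γ.Adj v w} :=
    ⟨hQ.toFinset, by simp⟩
  have hfin : Finite (Γ.ComponentCompl F) := Γ.componentCompl_finite F
  have key : ∀ P : Set V, P.Infinite → ∃ C : Γ.ComponentCompl F, (C.supp ∩ P).Infinite := by
    intro P hP
    by_contra! hcon
    refine hP ((F.finite_toSet.union
      (Set.finite_iUnion hcon)).subset fun v hv => ?_)
    by_cases hvF : v ∈ (F : Set V)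
    · exact Or.inl hvF
    · exact Or.inr (Set.mem_iUnion.2
        ⟨Γ.componentComplMk hvF, Γ.componentComplMk_mem hvF, hv⟩)
  -- Off the inner boundary `F` of `Q` no edge crosses between `Q` and its complement, so each
  -- component lies on one side. Infinite components on different sides would give two ends.
  let side : Γ.ComponentCompl F → Prop :=
    ComponentCompl.lift (fun v _ => v ∈ Q) (by
      intro v w hv hw hvw
      have hv' : ¬ (v ∈ Q ∧ ∃ w, w ∉ Q ∧ Γ.Adj v w) := fun h => hv (hF ▸ h)
      have hw' : ¬ (w ∈ Q ∧ ∃ v, v ∉ Q ∧ Γ.Adj w v) := fun h => hw (hF ▸ h)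
      refine propext ⟨fun h => ?_, fun h => ?_⟩
      · by_contra h'
        exact hv' ⟨h, w, h', hvw⟩
      · by_contra h'
        exact hw' ⟨h, v, h', hvw.symm⟩)
  have hside : ∀ (C : Γ.ComponentCompl F) (v : V), v ∈ C.supp → (side C ↔ v ∈ Q) := by
    rintro C v ⟨hv, rfl⟩
    exact Iff.rfl
  obtain ⟨C, hC⟩ := key Q h1
  obtain ⟨C', hC'⟩ := key Qᶜ h2
  obtain ⟨v, hv, hvQ⟩ := hC.nonempty
  obtain ⟨w, hw, hwQ⟩ := hC'.nonempty
  obtain ⟨e, he1, heC⟩ := exists_end_of_infinite hc hf F C (hC.mono Set.inter_subset_left)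
  obtain ⟨e', he1', heC'⟩ := exists_end_of_infinite hc hf F C' (hC'.mono Set.inter_subset_left)
  have hee : e = e' := he.unique he1 he1'
  have hCC : C = C' := by rw [← heC, ← heC', hee]
  refine hwQ ((hside C' w hw).1 ?_)
  rw [← hCC]
  exact (hside C v hv).2 hvQ

/-- An end would have to choose a component of the complement of all vertices. -/
lemma infinite_of_end (he : Γ.end.Nonempty) : Infinite V := by
  by_contra h
  have : Finite V := not_infinite_iff_finite.1 h
  obtain ⟨e, -⟩ := he
  cases nonempty_fintype V
  obtain ⟨v, hv⟩ := (e (Opposite.op Finset.univ)).nonempty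
  exact Set.disjoint_iff.1 (e (Opposite.op Finset.univ)).disjoint_right ⟨by simp, hv⟩

/-- Points on both sides of a set are close to its boundary. -/
lemma Connected.exists_boundary_near (hc : Γ.Connected) {P : Set V} {x y : V} (hx : x ∈ P)
    (hy : y ∉ P) : ∃ z ∈ {v | v ∈ P ∧ ∃ w, w ∉ P ∧ Γ.Adj v w}, Γ.dist z x ≤ Γ.dist x y := by
  classical
  obtain ⟨p, hp⟩ := hc.exists_walk_length_eq_dist x y
  obtain ⟨d, hd, h1, h2⟩ := p.exists_boundary_dart P hx hy
  refine ⟨d.fst, ⟨h1, d.snd, h2, d.adj⟩, ?_⟩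
  have hs := p.dart_fst_mem_support_of_mem_darts hd
  rw [dist_comm, ← hp]
  exact (dist_le (p.takeUntil _ hs)).trans (p.length_takeUntil_le_length hs)

end SimpleGraph

/-! ### Cayley-Abels graphs -/

lemma IsCompact.finite_image_mk {G : Type u} [Group G] [TopologicalSpace G]
    [IsTopologicalGroup G] {K : Set G} (hK : IsCompact K) {U : Subgroup G}
    (hU : IsOpen (U : Set G)) : ((QuotientGroup.mk : G → G ⧸ U) '' K).Finite := by
  have := QuotientGroup.discreteTopology hU
  exact (hK.image QuotientGroup.continuous_mk).finite_of_discrete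

namespace CayleyAbelsData

variable {G : Type u} [Group G] [TopologicalSpace G] {𝓗 : Set (Subgroup G)}

lemma graph_adj_iff (D : CayleyAbelsData 𝓗) {x y : G ⧸ D.U} : D.graph.Adj x y ↔ x ≠ y ∧
    ∃ g : G, ∃ s ∈ D.S, x = (QuotientGroup.mk g : G ⧸ D.U) ∧
      y = (QuotientGroup.mk (g * s) : G ⧸ D.U) := by
  rw [graph, SimpleGraph.fromRel_adj]
  refine and_congr_right fun _ => ⟨?_, Or.inl⟩
  rintro (h | ⟨g, s, hs, rfl, rfl⟩)
  · exact h
  · refine ⟨g * s, s⁻¹, ?_, rfl, by simp⟩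
    rw [← D.S_symm]
    simpa using hs

lemma graph_adj_or_eq (D : CayleyAbelsData 𝓗) (g : G) {s : G} (hs : s ∈ D.S) :
    (QuotientGroup.mk g : G ⧸ D.U) = QuotientGroup.mk (g * s) ∨
      D.graph.Adj (QuotientGroup.mk g) (QuotientGroup.mk (g * s)) := by
  by_cases h : (QuotientGroup.mk g : G ⧸ D.U) = QuotientGroup.mk (g * s)
  · exact Or.inl h
  · exact Or.inr (D.graph_adj_iff.2 ⟨h, g, s, hs, rfl, rfl⟩)

lemma graph_smul_adj (D : CayleyAbelsData 𝓗) (g : G) {x y : G ⧸ D.U} (h : D.graph.Adj x y) :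
    D.graph.Adj (g • x) (g • y) := by
  obtain ⟨hne, t, s, hs, rfl, rfl⟩ := D.graph_adj_iff.1 h
  refine D.graph_adj_iff.2 ⟨fun h' => hne (MulAction.injective g h'), g * t, s, hs, rfl, ?_⟩
  rw [mul_assoc]
  rfl

lemma mk_mul_eq (D : CayleyAbelsData 𝓗) (g : G) {k : G} (hk : k ∈ D.U) :
    (QuotientGroup.mk (g * k) : G ⧸ D.U) = QuotientGroup.mk g :=
  QuotientGroup.mk_mul_of_mem g hk

lemma graph_connected (D : CayleyAbelsData 𝓗) : D.graph.Connected := by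
  -- A generator `k = s * w` with `w ∈ U` moves `gU` to `gsU`, along at most one edge.
  have key : ∀ h ∈ Subgroup.closure D.K, ∀ g : G,
      D.graph.Reachable (QuotientGroup.mk g) (QuotientGroup.mk (g * h)) := by
    intro h hh
    induction hh using Subgroup.closure_induction with
    | mem k hk =>
      intro g
      obtain ⟨s, hs, w, hw, rfl⟩ := D.K_subset hk
      change D.graph.Reachable _ (QuotientGroup.mk (g * (s * w)))
      rw [← mul_assoc, D.mk_mul_eq _ hw]
      rcases D.graph_adj_or_eq g hs with h | h
      · rw [h]
      · exact h.reachable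
    | one => intro g; simp
    | mul a b _ _ iha ihb =>
      intro g
      rw [← mul_assoc]
      exact (iha g).trans (ihb _)
    | inv a _ ih =>
      intro g
      simpa using (ih (g * a⁻¹)).symm
  have : Nonempty (G ⧸ D.U) := ⟨QuotientGroup.mk 1⟩
  refine ⟨fun x y => ?_⟩
  obtain ⟨g, rfl⟩ := QuotientGroup.mk_surjective x
  obtain ⟨g', rfl⟩ := QuotientGroup.mk_surjective y
  have := key (g⁻¹ * g') (by rw [D.closure_K]; trivial) g
  rwa [mul_inv_cancel_left] at this

lemma cosetVertices_connected (D : CayleyAbelsData 𝓗) (c : PeripheralCoset 𝓗) :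
    (D.graph.induce (D.cosetVertices c)).Connected := by
  have hmem : ∀ {g : G}, (QuotientGroup.mk g : G ⧸ (c.1 : Subgroup G)) = c.2 →
      (QuotientGroup.mk g : G ⧸ D.U) ∈ D.cosetVertices c := fun {g} hg => ⟨g, hg, rfl⟩
  have hmul : ∀ {g h : G}, (QuotientGroup.mk g : G ⧸ (c.1 : Subgroup G)) = c.2 →
      h ∈ (c.1 : Subgroup G) → (QuotientGroup.mk (g * h) : G ⧸ (c.1 : Subgroup G)) = c.2 :=
    fun {g h} hg hh => (QuotientGroup.mk_mul_of_mem g hh).trans hg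
  have key : ∀ h ∈ Subgroup.closure (D.KH c.1), ∀ (g : G)
      (hg : (QuotientGroup.mk g : G ⧸ (c.1 : Subgroup G)) = c.2)
      (hgh : (QuotientGroup.mk (g * h) : G ⧸ (c.1 : Subgroup G)) = c.2),
      (D.graph.induce (D.cosetVertices c)).Reachable ⟨_, hmem hg⟩ ⟨_, hmem hgh⟩ := by
    intro h hh
    induction hh using Subgroup.closure_induction with
    | mem k hk =>
      intro g hg hgh
      obtain ⟨s, hs, w, hw, rfl⟩ := D.KH_subset c.1 hk
      have e : (QuotientGroup.mk (g * (s * w)) : G ⧸ D.U) = QuotientGroup.mk (g * s) := by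
        rw [← mul_assoc, D.mk_mul_eq _ hw.1]
      rcases D.graph_adj_or_eq g (D.SH_subset_S c.1 hs) with h | h
      · have : (⟨_, hmem hg⟩ : D.cosetVertices c) = ⟨_, hmem hgh⟩ :=
          Subtype.ext (h.trans e.symm)
        rw [this]
      · refine SimpleGraph.Adj.reachable ?_
        change D.graph.Adj (QuotientGroup.mk g) (QuotientGroup.mk (g * (s * w)))
        rwa [e]
    | one =>
      intro g hg hgh
      simp only [mul_one]
      exact SimpleGraph.Reachable.refl _
    | mul a b ha hb iha ihb =>
      intro g hg hgh
      rw [D.closure_KH] at ha hb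
      simp only [← mul_assoc]
      exact (iha g hg (hmul hg ha)).trans (ihb (g * a) (hmul hg ha) (by rwa [mul_assoc]))
    | inv a ha ih =>
      intro g hg hgh
      have := (ih (g * a⁻¹) hgh (by simpa using hg)).symm
      simpa using this
  obtain ⟨t, ht⟩ := QuotientGroup.mk_surjective c.2
  have : Nonempty (D.cosetVertices c) := ⟨⟨_, hmem ht⟩⟩
  refine ⟨?_⟩
  rintro ⟨_, g, hg, rfl⟩ ⟨_, g', hg', rfl⟩
  have h := key (g⁻¹ * g') (by
    rw [D.closure_KH]; exact QuotientGroup.eq.1 (hg.trans hg'.symm)) g hg (by simpa using hg')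
  simpa using h

section Topology

variable [IsTopologicalGroup G]

/-- Here `g` ranges over the compact set `g₀ U`, and `G ⧸ H` is discrete. The case `H = U` gives
local finiteness, `s = 1` the finiteness of the cosets through a vertex. -/
lemma finite_setOf_mk_eq (D : CayleyAbelsData 𝓗) (g₀ : G) {H : Subgroup G}
    (hH : IsOpen (H : Set G)) (s : G) :
    {y : G ⧸ H | ∃ g : G, (QuotientGroup.mk g : G ⧸ D.U) = QuotientGroup.mk g₀ ∧
      (QuotientGroup.mk (g * s) : G ⧸ H) = y}.Finite := by
  have hc : IsCompact ((fun x : G => g₀ * x * s) '' (D.U : Set G)) :=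
    D.U_isCompact.image (by fun_prop)
  refine (hc.finite_image_mk hH).subset ?_
  rintro _ ⟨g, hg, rfl⟩
  refine ⟨g * s, ⟨g₀⁻¹ * g, QuotientGroup.eq.1 hg.symm, by simp⟩, rfl⟩

lemma graph_neighborSet_finite (D : CayleyAbelsData 𝓗) (x : G ⧸ D.U) :
    (D.graph.neighborSet x).Finite := by
  obtain ⟨g₀, rfl⟩ := QuotientGroup.mk_surjective x
  refine (D.S_finite.biUnion fun s _ => D.finite_setOf_mk_eq g₀ D.U_isOpen s).subset ?_
  intro y hy
  obtain ⟨-, g, s, hs, hg, rfl⟩ := D.graph_adj_iff.1 hy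
  simp only [Set.mem_iUnion]
  exact ⟨s, hs, g, hg.symm, rfl⟩

lemma finite_setOf_mem_cosetVertices (D : CayleyAbelsData 𝓗) (hfin : 𝓗.Finite)
    (hopen : ∀ H ∈ 𝓗, IsOpen (H : Set G)) (x : G ⧸ D.U) :
    {c | x ∈ D.cosetVertices c}.Finite := by
  obtain ⟨g₀, rfl⟩ := QuotientGroup.mk_surjective x
  have : Finite 𝓗 := hfin
  refine (Set.finite_iUnion fun H : 𝓗 =>
    (D.finite_setOf_mk_eq g₀ (hopen H.1 H.2) 1).image (Sigma.mk H)).subset ?_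
  rintro ⟨H, q⟩ ⟨g, hq, hx⟩
  simp only [Set.mem_iUnion]
  exact ⟨H, q, ⟨g, hx, by simpa using hq⟩, rfl⟩

lemma isCompact_preimage_mk (D : CayleyAbelsData 𝓗) {T : Set (G ⧸ D.U)} (hT : T.Finite) :
    IsCompact ((QuotientGroup.mk : G → G ⧸ D.U) ⁻¹' T) := by
  rw [← Set.biUnion_preimage_singleton]
  refine hT.isCompact_biUnion fun x _ => ?_
  obtain ⟨g, rfl⟩ := QuotientGroup.mk_surjective x
  convert D.U_isCompact.image (f := fun u => g * u) (by fun_prop) using 1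
  ext h
  constructor
  · intro hh
    exact ⟨g⁻¹ * h, QuotientGroup.eq.1 (Eq.symm hh), by simp⟩
  · rintro ⟨w, hw, rfl⟩
    exact D.mk_mul_eq g hw

/-- Otherwise `tH` would lie in a finite union of cosets of `U`, making the closed subgroup `H`
compact. -/
lemma cosetVertices_infinite (D : CayleyAbelsData 𝓗) (c : PeripheralCoset 𝓗)
    (hopen : IsOpen ((c.1 : Subgroup G) : Set G))
    (hnc : ¬ IsCompact ((c.1 : Subgroup G) : Set G)) : (D.cosetVertices c).Infinite := by
  intro hfin
  obtain ⟨t, ht⟩ := QuotientGroup.mk_surjective c.2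
  have h1 := (D.isCompact_preimage_mk hfin).image (f := fun g => t⁻¹ * g) (by fun_prop)
  refine hnc (h1.of_isClosed_subset (Subgroup.isClosed_of_isOpen _ hopen) fun h hh => ?_)
  exact ⟨t * h, ⟨t * h, (QuotientGroup.mk_mul_of_mem t hh).trans ht, rfl⟩, by simp⟩

end Topology

end CayleyAbelsData

namespace IsCayleyAbelsGraph

variable {G : Type u} [Group G] [TopologicalSpace G] {V : Type v}
  [MulAction G V] {Γ : SimpleGraph V}

/-- The preimage form yields openness, the image form compactness. -/
lemma preimage_smul_eq (hΓ : IsCayleyAbelsGraph G Γ) (v w : V) :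
    ∃ g : G, {h : G | h • v = w} = (fun h => g⁻¹ * h) ⁻¹' (MulAction.stabilizer G v : Set G) ∧
      {h : G | h • v = w} = (fun h => g * h) '' (MulAction.stabilizer G v : Set G) := by
  obtain ⟨g, rfl⟩ := hΓ.transitive v w
  have h1 : {h : G | h • v = g • v} =
      (fun h => g⁻¹ * h) ⁻¹' (MulAction.stabilizer G v : Set G) := by
    ext h
    simp [MulAction.mem_stabilizer_iff, mul_smul, inv_smul_eq_iff]
  refine ⟨g, h1, h1.trans ?_⟩
  rw [Set.image_mul_left]

variable [IsTopologicalGroup G]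

lemma isOpen_setOf_smul_eq (hΓ : IsCayleyAbelsGraph G Γ) (v w : V) :
    IsOpen {h : G | h • v = w} := by
  obtain ⟨g, hg, -⟩ := hΓ.preimage_smul_eq v w
  rw [hg]
  exact (hΓ.stabilizer_isOpen v).preimage (by fun_prop)

lemma isCompact_setOf_smul_mem (hΓ : IsCayleyAbelsGraph G Γ) (v : V) {T : Set V}
    (hT : T.Finite) : IsCompact {h : G | h • v ∈ T} := by
  have : {h : G | h • v ∈ T} = ⋃ w ∈ T, {h : G | h • v = w} := by ext; simp
  rw [this]
  refine hT.isCompact_biUnion fun w _ => ?_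
  obtain ⟨g, -, hg⟩ := hΓ.preimage_smul_eq v w
  rw [hg]
  exact (hΓ.stabilizer_isCompact v).image (by fun_prop)

lemma finite_image_smul (hΓ : IsCayleyAbelsGraph G Γ) (v : V) {K : Set G} (hK : IsCompact K) :
    ((fun h : G => h • v) '' K).Finite := by
  let _ : TopologicalSpace V := ⊥
  have : DiscreteTopology V := ⟨rfl⟩
  have hcont : Continuous fun h : G => h • v :=
    continuous_discrete_rng.2 fun w => hΓ.isOpen_setOf_smul_eq v w
  exact (hK.image hcont).finite_of_discrete

end IsCayleyAbelsGraph

/-! ### Independence of one-endedness from the Cayley–Abels graph -/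

namespace CayleyAbelsData

variable {G : Type u} [Group G] [TopologicalSpace G] {𝓗 : Set (Subgroup G)}

lemma graph_dist_smul_le (D : CayleyAbelsData 𝓗) (g : G) (x y : G ⧸ D.U) :
    D.graph.dist (g • x) (g • y) ≤ D.graph.dist x y := by
  obtain ⟨p, hp⟩ := D.graph_connected.exists_walk_length_eq_dist x y
  let f : D.graph →g D.graph := ⟨fun x => g • x, fun h => D.graph_smul_adj g h⟩
  rw [← hp, ← p.length_map f]
  exact SimpleGraph.dist_le (p.map f)

variable [IsTopologicalGroup G]

lemma exists_dist_bound (D : CayleyAbelsData 𝓗) {K : Set G} (hK : IsCompact K) :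
    ∃ R : ℕ, ∀ g : G, ∀ k ∈ K, D.graph.dist (QuotientGroup.mk g) (QuotientGroup.mk (g * k)) ≤ R := by
  obtain ⟨R, hR⟩ := ((hK.finite_image_mk D.U_isOpen).image
    (D.graph.dist (QuotientGroup.mk (1 : G)))).bddAbove
  refine ⟨R, fun g k hk => ?_⟩
  have h1 : D.graph.dist (QuotientGroup.mk (1 : G)) (QuotientGroup.mk k) ≤ R :=
    hR ⟨_, ⟨k, hk, rfl⟩, rfl⟩
  have h2 := D.graph_dist_smul_le g (QuotientGroup.mk (1 : G)) (QuotientGroup.mk k)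
  have e1 : g • (QuotientGroup.mk (1 : G) : G ⧸ D.U) = QuotientGroup.mk (g * 1) := rfl
  have e2 : g • (QuotientGroup.mk k : G ⧸ D.U) = QuotientGroup.mk (g * k) := rfl
  rw [e1, e2, mul_one] at h2
  exact h2.trans h1

/-- Having one end does not depend on the choice of the Cayley-Abels graph. -/
lemma infinite_and_finite_or_finite_compl (D : CayleyAbelsData 𝓗) (h_end : HasOneRoughEnd G) :
    Infinite (G ⧸ D.U) ∧ ∀ P : Set (G ⧸ D.U),
      {v | v ∈ P ∧ ∃ w, w ∉ P ∧ D.graph.Adj v w}.Finite → P.Finite ∨ Pᶜ.Finite := by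
  obtain ⟨V, _, Γ, hΓ, he⟩ := h_end
  obtain ⟨v₀⟩ := hΓ.connected.nonempty
  choose g hg using hΓ.transitive v₀
  -- This map is coarsely Lipschitz (`hadj`), coarsely onto (`hsurj`) and has finite fibres
  -- (`hfib`), which suffices to pull back sets with finite boundary.
  let π : V → G ⧸ D.U := fun v => QuotientGroup.mk (g v)
  have hX := D.graph_connected
  have hXp := hX.isProper D.graph_neighborSet_finite
  have hfib : ∀ x, (π ⁻¹' {x}).Finite := by
    intro x
    refine (hΓ.finite_image_smul v₀ (D.isCompact_preimage_mk (Set.finite_singleton x))).subset ?_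
    exact fun v hv => ⟨g v, hv, hg v⟩
  refine ⟨?_, fun P hP => ?_⟩
  · have hV := SimpleGraph.infinite_of_end he.exists
    by_contra hfin
    have : Finite (G ⧸ D.U) := not_infinite_iff_finite.1 hfin
    refine Set.infinite_univ (α := V) (((Set.finite_univ (α := G ⧸ D.U)).preimage'
      (f := π) fun x _ => hfib x).subset fun v _ => Set.mem_univ _)
  obtain ⟨R, hR⟩ := D.exists_dist_bound
    (hΓ.isCompact_setOf_smul_mem v₀ (hΓ.locallyFinite v₀))
  obtain ⟨R', hR'⟩ := D.exists_dist_bound (hΓ.stabilizer_isCompact v₀)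
  have hadj : ∀ v w, Γ.Adj v w → D.graph.dist (π v) (π w) ≤ R := by
    intro v w hvw
    have := hR (g v) ((g v)⁻¹ * g w) (by
      have h2 := hΓ.smul_adj (g v)⁻¹ _ _ hvw
      have e : (g v)⁻¹ • v = v₀ := by rw [inv_smul_eq_iff, hg]
      rw [e] at h2
      change Γ.Adj v₀ (((g v)⁻¹ * g w) • v₀)
      rwa [mul_smul, hg])
    rwa [mul_inv_cancel_left] at this
  have hsurj : ∀ x, ∃ v, D.graph.dist x (π v) ≤ R' := by
    intro x
    obtain ⟨t, rfl⟩ := QuotientGroup.mk_surjective x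
    refine ⟨t • v₀, ?_⟩
    have := hR' t (t⁻¹ * g (t • v₀)) (by
      change (t⁻¹ * g (t • v₀)) • v₀ = v₀
      rw [mul_smul, hg, inv_smul_smul])
    rwa [mul_inv_cancel_left] at this
  have hball : ∀ (T : Set (G ⧸ D.U)) (n : ℕ), T.Finite →
      (⋃ z ∈ T, {y | D.graph.dist z y ≤ n}).Finite := fun T n hT => hT.biUnion fun z _ => hXp z n
  have hQ : {v | v ∈ π ⁻¹' P ∧ ∃ w, w ∉ π ⁻¹' P ∧ Γ.Adj v w}.Finite := by
    refine ((hball _ R hP).preimage' (f := π) fun x _ => hfib x).subset ?_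
    rintro v ⟨hv, w, hw, hvw⟩
    obtain ⟨z, hz, hd⟩ := hX.exists_boundary_near (P := P) hv hw
    simp only [Set.mem_preimage, Set.mem_iUnion]
    exact ⟨z, hz, hd.trans (hadj v w hvw)⟩
  -- Used for `P` and `Pᶜ`. A point of `P'` is near the finite image of its preimage or near the
  -- boundary of `P`; as that boundary lies inside `P`, the case of `Pᶜ` needs `R'` twice.
  have key : ∀ P' : Set (G ⧸ D.U), (π ⁻¹' P').Finite →
      (∀ x v, x ∈ P' → π v ∉ P' → D.graph.dist x (π v) ≤ R' →
        x ∈ ⋃ z ∈ {v | v ∈ P ∧ ∃ w, w ∉ P ∧ D.graph.Adj v w},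
          {y | D.graph.dist z y ≤ 2 * R'}) → P'.Finite := by
    intro P' hfin hb
    refine ((hball _ (2 * R') hP).union (hball (π '' (π ⁻¹' P')) R' (hfin.image π))).subset ?_
    intro x hx
    obtain ⟨v, hv⟩ := hsurj x
    by_cases hvP : π v ∈ P'
    · right
      simp only [Set.mem_iUnion]
      exact ⟨π v, ⟨v, hvP, rfl⟩, by rwa [Set.mem_ofPred_eq, SimpleGraph.dist_comm]⟩
    · exact Or.inl (hb x v hx hvP hv)
  rcases SimpleGraph.finite_or_finite_compl_of_end hΓ.connected hΓ.locallyFinite he _ hQ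
    with h | h
  · refine Or.inl (key P h fun x v hx hv hd => ?_)
    obtain ⟨z, hz, hzd⟩ := hX.exists_boundary_near (P := P) hx hv
    simp only [Set.mem_iUnion]
    exact ⟨z, hz, by simp only [Set.mem_ofPred_eq]; omega⟩
  · refine Or.inr (key Pᶜ h fun x v hx hv hd => ?_)
    obtain ⟨z, hz, hzd⟩ := hX.exists_boundary_near (P := P) (not_not.1 hv) hx
    simp only [Set.mem_iUnion]
    refine ⟨z, hz, ?_⟩
    have := hX.dist_triangle (u := z) (v := π v) (w := x)
    rw [D.graph.dist_comm (u := π v)] at hzd this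
    simp only [Set.mem_ofPred_eq]
    omega

end CayleyAbelsData

/-! ### The action on the augmented graph -/

namespace CayleyAbelsData

variable {G : Type u} [Group G] [TopologicalSpace G] {𝓗 : Set (Subgroup G)}

/-- The action of a group element on the set of peripheral cosets. -/
def cosetShift (g : G) (c : PeripheralCoset 𝓗) : PeripheralCoset 𝓗 := ⟨c.1, g • c.2⟩

lemma smul_mem_cosetVertices (D : CayleyAbelsData 𝓗) (g : G) {c : PeripheralCoset 𝓗}
    {x : G ⧸ D.U} (hx : x ∈ D.cosetVertices c) : g • x ∈ D.cosetVertices (cosetShift g c) := by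
  obtain ⟨t, ht, rfl⟩ := hx
  refine ⟨g * t, ?_, rfl⟩
  change _ = g • c.2
  rw [← ht]
  rfl

/-- The action of a group element on a coset. -/
def cosetMap (D : CayleyAbelsData 𝓗) (g : G) (c : PeripheralCoset 𝓗) (y : D.cosetVertices c) :
    D.cosetVertices (cosetShift g c) := ⟨g • y.1, D.smul_mem_cosetVertices g y.2⟩

/-- The action of a group element on the vertices of the augmented graph. -/
def vertexMap (D : CayleyAbelsData 𝓗) (g : G) : D.Vertex → D.Vertex
  | Sum.inl x => Sum.inl (g • x)
  | Sum.inr ⟨c, y, k⟩ => Sum.inr ⟨cosetShift g c, D.cosetMap g c y, k⟩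

lemma vertexMap_ofHoroball (D : CayleyAbelsData 𝓗) (g : G) (c : PeripheralCoset 𝓗)
    (y : D.cosetVertices c) (k : ℕ) :
    D.vertexMap g (AugmentedVertex.ofHoroball _ c (y, k)) =
      AugmentedVertex.ofHoroball _ (cosetShift g c) (D.cosetMap g c y, k) := by
  cases k <;> rfl

lemma vertexMap_inv (D : CayleyAbelsData 𝓗) (g : G) (x : D.Vertex) :
    D.vertexMap g⁻¹ (D.vertexMap g x) = x := by
  -- The index `g⁻¹ • g • c` equals `c` only propositionally, so vertices are compared through their
  -- underlying cosets.
  have aux : ∀ (c c' : PeripheralCoset 𝓗) (y : D.cosetVertices c) (y' : D.cosetVertices c')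
      (k : ℕ), c = c' → y.1 = y'.1 →
      (Sum.inr ⟨c, y, k⟩ : D.Vertex) = Sum.inr ⟨c', y', k⟩ := by
    rintro c _ y y' k rfl hy
    rw [Subtype.ext hy]
  rcases x with x | ⟨c, y, k⟩
  · exact congrArg Sum.inl (inv_smul_smul g x)
  · refine aux _ _ _ _ _ ?_ (inv_smul_smul g y.1)
    obtain ⟨H, q⟩ := c
    exact congrArg (Sigma.mk H) (inv_smul_smul g q)

lemma vertexMap_adj (D : CayleyAbelsData 𝓗) (g : G) {x y : D.Vertex}
    (h : D.augmentedGraph.Adj x y) :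
    D.augmentedGraph.Adj (D.vertexMap g x) (D.vertexMap g y) := by
  rcases SimpleGraph.augment_adj_cases h with
    ⟨v, w, hvw, rfl, rfl⟩ | ⟨c, ⟨p, k⟩, ⟨q, l⟩, hpq, rfl, rfl⟩
  · exact SimpleGraph.augment_adj_inl (D.graph_smul_adj g hvw)
  · rw [vertexMap_ofHoroball, vertexMap_ofHoroball]
    have hv : ∀ p k, D.augmentedGraph.Adj
        (AugmentedVertex.ofHoroball _ (cosetShift g c) (D.cosetMap g c p, k))
        (AugmentedVertex.ofHoroball _ (cosetShift g c) (D.cosetMap g c p, k + 1)) :=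
      fun p k => SimpleGraph.augment_adj_vertical _ _ _
    rcases SimpleGraph.combinatorialHoroball_adj_cases hpq with h | h | h | h
    · obtain ⟨rfl, rfl, h'⟩ : k = 0 ∧ l = 0 ∧ D.graph.Adj p.1 q.1 := h
      exact SimpleGraph.augment_adj_inl (D.graph_smul_adj g h')
    · obtain ⟨hk, rfl, h0, h1⟩ := h
      simp only at hk h0 h1
      refine SimpleGraph.augment_adj_horizontal _ hk ?_ ?_
      -- Positivity needs connectedness of the target coset, to exclude the default value `0` of
      -- `dist`.
      · refine (D.cosetVertices_connected _).pos_dist_of_ne fun he => ?_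
        have : p = q := Subtype.ext (MulAction.injective g (congrArg Subtype.val he))
        simp [this] at h0
      · obtain ⟨w, hw⟩ := (D.cosetVertices_connected c).exists_walk_length_eq_dist p q
        let f : D.graph.induce (D.cosetVertices c) →g
            D.graph.induce (D.cosetVertices (cosetShift g c)) :=
          ⟨D.cosetMap g c, fun h => D.graph_smul_adj g h⟩
        have := SimpleGraph.dist_le (w.map f)
        rw [w.length_map, hw] at this
        exact this.trans h1
    · obtain ⟨rfl, rfl⟩ : p = q ∧ l = k + 1 := h
      exact hv p k
    · obtain ⟨rfl, rfl⟩ : p = q ∧ k = l + 1 := h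
      exact (hv p l).symm

lemma augmentedGraph_connected (D : CayleyAbelsData 𝓗) : D.augmentedGraph.Connected :=
  SimpleGraph.augment_connected D.graph_connected

lemma augmentedGraph_dist_vertexMap (D : CayleyAbelsData 𝓗) (g : G) (x y : D.Vertex) :
    D.augmentedGraph.dist (D.vertexMap g x) (D.vertexMap g y) = D.augmentedGraph.dist x y := by
  have key : ∀ (g : G) (x y : D.Vertex),
      D.augmentedGraph.dist (D.vertexMap g x) (D.vertexMap g y) ≤ D.augmentedGraph.dist x y := by
    intro g x y
    obtain ⟨p, hp⟩ := D.augmentedGraph_connected.exists_walk_length_eq_dist x y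
    let f : D.augmentedGraph →g D.augmentedGraph := ⟨D.vertexMap g, fun h => D.vertexMap_adj g h⟩
    rw [← hp, ← p.length_map f]
    exact SimpleGraph.dist_le (p.map f)
  refine le_antisymm (key g x y) ?_
  simpa only [vertexMap_inv] using key g⁻¹ (D.vertexMap g x) (D.vertexMap g y)

end CayleyAbelsData

theorem theorem1p6 {G : Type u} [Group G] [TopologicalSpace G] [IsTopologicalGroup G] [T2Space G]
    [LocallyCompactSpace G] [TotallyDisconnectedSpace G]
    (hG : (⊤ : Subgroup G).IsCompactlyGen)
    (𝓗 : Set (Subgroup G))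
    (h_gen : ∀ H ∈ 𝓗, H.IsCompactlyGen)
    (h_noncompact : ∀ H ∈ 𝓗, ¬ IsCompact (H : Set G))
    (D : CayleyAbelsData 𝓗) (h_hyp : D.IsRelativelyHyperbolic)
    (h_end : HasOneRoughEnd G) (x₀ : D.Vertex) :
    ConnectedSpace (D.BowditchBoundary x₀) := by
  obtain ⟨hpair, hhyp⟩ := h_hyp
  obtain ⟨hinf, hone⟩ := D.infinite_and_finite_or_finite_compl h_end
  have hc := D.augmentedGraph_connected
  have hp : D.augmentedGraph.IsProper := hc.isProper
    (SimpleGraph.augment_neighborSet_finite D.graph_neighborSet_finite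
      (D.finite_setOf_mem_cosetVertices hpair.finite hpair.isOpen) D.cosetVertices_connected)
  refine SimpleGraph.gromovBoundary_connectedSpace D.graph Sum.inl hhyp hc hp x₀
    (QuotientGroup.mk 1) Sum.inl_injective (fun v w h => ?_) (fun v => ?_) hone (fun a R => ?_)
  · exact (SimpleGraph.dist_eq_one_iff_adj.2 (SimpleGraph.augment_adj_inl h)).le
  · obtain ⟨g, rfl⟩ := QuotientGroup.mk_surjective v
    refine ⟨D.vertexMap g, D.augmentedGraph_dist_vertexMap g, ?_⟩
    change Sum.inl (QuotientGroup.mk (g * 1)) = _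
    rw [mul_one]
  · obtain ⟨δ, hδ⟩ := hhyp
    exact SimpleGraph.infinite_setOf_le_gromovProd (δ := δ) hδ hc hp D.cosetVertices_connected
      (fun c => D.cosetVertices_infinite c (hpair.isOpen _ c.1.2) (h_noncompact _ c.1.2)) a R
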